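/- **Setting.** A *BAUML model* is a tuple $\mathcal B=\langle \mathcal M,\mathcal O,\mathcal S,\mathcal P\rangle$, where * $\mathcal M$ is a UML class diagram: classes with an acyclic is-a relation, string and boolean attributes (each of multiplicity one), and binary associations with cardinality constraints. Some classes are *artifacts*; each artifact $A$ is the top class of its own hierarchy, and each instance of $A$ belongs to exactly one leaf of that hierarchy, its current state. * $\mathcal O$ is a finite set of OCL constraints over $\mathcal M$. * $\mathcal S$ contains one state transition diagram for each artifact $A$. Its states are the leaves of the hierarchy of $A$; it has an initial state, a designated *proper termination state* $T_A$, initial transitions (which create an instance of $A$ in the initial state), and transitions between states; each transition is labelled by an event and an OCL condition. * $\mathcal P$ contains exactly one activity diagram for each event, built from an initial node, atomic tasks, decision/merge nodes with OCL guards, fork/join nodes and final nodes. Each task has an operation contract, i.e. an OCL precondition and an OCL postcondition, with input parameters that are supplied nondeterministically. The model is *unrestricted*: the OCL expressions in it may have arbitrary shape (well-typed expressions built from variables, string constants, $C.allInstances()$, attributes, navigation of associations in both directions, $oclAsType$, select, collect, union, intersection, difference, Boolean connectives, equality, inclusion, emptiness, exists, $oclIsTypeOf$, $oclIsKindOf$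 and, in postconditions, $oclIsNew$ and $@pre$). Data come from a countably infinite unordered domain and can only be compared for equality. **Execution.** A state of the system consists of a finite information base (an instance of $\mathcal M$) and of the activities that are currently running, each with its position and its artifact instance. The system starts from the empty information base (which is assumed to satisfy $\mathcal O$) with no running activity. In one step, an initial transition is started, or a transition is started for an existing artifact instance that is in its source state and takes part in no other transition, provided that its condition holds; or a running activity makes one move of its control flow, executes one task, or ends, the instance then being in the target state of the transition. A task can be executed, for some values of its parameters, if its precondition holds; it leads to an information base that conforms to $\mathcal M$, satisfies $\mathcal O$ and satisfies the postcondition. We consider two readings of postconditions: the *permissive* one, in which every such information base may result, and the *inertial* one, in which moreover the set of facts that change has to be minimal with respect to inclusion among the information bases that are possible for the same inputs and the same returned object. **Artifact termination.** $\mathcal B$ *satisfies artifact termination* if the initial state of the transition system so obtained satisfies $$\nu Z.\Big(\bigwedge_{A}\ \forall x.\,A(x)\rightarrow \mu Y.\,\big(T_A(x)\lor (A(x)\land\langle-\rangle Y)\big)\Big)\land[-]Z ,$$ where $A$ ranges over the artifacts of $\mathcal B$, $\langle-\rangle Y$ means that some successor state satisfies $Y$, and $[-]Z$ that all successor states satisfy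 $Z$; that is, whenever an instance $x$ of an artifact $A$ is present in a reachable state, the system can evolve so that $x$ persists as an instance of $A$ until it reaches the termination state $T_A$. **Theorem.** Checking artifact termination over unrestricted BAUML models is undecidable: under each of the two readings of postconditions, there is no algorithm (no computable function $f$ from codes of models to $\{\mathrm{true},\mathrm{false}\}$, for an explicit injective coding of models by natural numbers) that, for every well-formed BAUML model $\mathcal B$, decides whether $\mathcal B$ satisfies artifact termination. -/

import Mathlib

namespace BAUML

/-! ### Data, information bases

Object identifiers and strings are two copies of a countably infinite unordered set (natural
numbers serve as names; expressions can only test for equality). Classes, attributes and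
associations are named by natural numbers. -/

inductive Val : Type
  | obj (o : ℕ)
  | str (v : ℕ)

/-- Ground facts: `o` is an instance of class `c`; attribute `a` of `o` has value `v`;
association `r` links `o` to `o'`. -/
inductive Fact : Type
  | inst (c o : ℕ)
  | attr (a o v : ℕ)
  | link (r o o' : ℕ)
  deriving DecidableEq

/-- An information base is a finite set of facts. -/
abbrev Snapshot := Finset Fact

/-- `o` occurs in the information base as an instance of some class. -/
def Snapshot.Live (s : Snapshot) (o : ℕ) : Prop := ∃ c, Fact.inst c o ∈ s

/-! ### Class diagrams -/

/-- A string attribute (a boolean one if `isBool`) of class `owner`. -/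
structure Attribute where
  owner : ℕ
  isBool : Bool

/-- A cardinality constraint `lo..hi`; `none` is the upper bound `*`. -/
structure Mult where
  lo : ℕ
  hi : Option ℕ

/-- A binary association from class `dom` to class `img`. Each object of `dom` is linked to
`imgMult` objects of `img`, each object of `img` to `domMult` objects of `dom`. -/
structure Association where
  dom : ℕ
  img : ℕ
  domMult : Mult
  imgMult : Mult

/-- The classes are `0, …, numClasses - 1`; `(c, d) ∈ isa` says that `c` is a direct subclass of
`d`; an attribute or association is named by its position in the list. -/
structure ClassDiagram where
  numClasses : ℕ
  isa : List (ℕ × ℕ)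
  attrs : List Attribute
  assocs : List Association

namespace ClassDiagram

/-- `c = d`, or `c` is a direct or indirect subclass of `d`. -/
def IsA (D : ClassDiagram) : ℕ → ℕ → Prop :=
  Relation.ReflTransGen fun c d => (c, d) ∈ D.isa

/-- `c` is a leaf of the hierarchy with top class `A`. -/
def IsLeaf (D : ClassDiagram) (A c : ℕ) : Prop :=
  D.IsA c A ∧ ∀ d, (d, c) ∉ D.isa

structure WellFormed (D : ClassDiagram) : Prop where
  isa_lt : ∀ p ∈ D.isa, p.1 < D.numClasses ∧ p.2 < D.numClasses
  isa_acyclic : ∀ c, ¬ Relation.TransGen (fun c d => (c, d) ∈ D.isa) c c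
  attr_lt : ∀ a ∈ D.attrs, a.owner < D.numClasses
  assoc_lt : ∀ r ∈ D.assocs, r.dom < D.numClasses ∧ r.img < D.numClasses
  mult_le : ∀ r ∈ D.assocs,
    (∀ h ∈ r.domMult.hi, r.domMult.lo ≤ h) ∧ (∀ h ∈ r.imgMult.hi, r.imgMult.lo ≤ h)

end ClassDiagram

def Mult.Allows (m : Mult) (X : Set ℕ) : Prop :=
  (m.lo : ℕ∞) ≤ X.encard ∧ ∀ h ∈ m.hi, X.encard ≤ (h : ℕ∞)

/-- `s` is an instance of the class diagram `D` in which the classes `arts` are artifacts. Boolean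
attributes take one of the two special strings `0` and `1`. Every instance of an artifact is in
exactly one of the leaf subclasses of the artifact (its current state). -/
structure Snapshot.Legal (D : ClassDiagram) (arts : List ℕ) (s : Snapshot) : Prop where
  class_lt : ∀ c o, Fact.inst c o ∈ s → c < D.numClasses
  isa : ∀ c d o, (c, d) ∈ D.isa → Fact.inst c o ∈ s → Fact.inst d o ∈ s
  attr_typed : ∀ a o v, Fact.attr a o v ∈ s →
    ∃ d, D.attrs[a]? = some d ∧ Fact.inst d.owner o ∈ s ∧ (d.isBool = true → v = 0 ∨ v = 1)
  attr_value : ∀ a (d : Attribute), D.attrs[a]? = some d → ∀ o, Fact.inst d.owner o ∈ s →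
    ∃! v, Fact.attr a o v ∈ s
  link_typed : ∀ r o o', Fact.link r o o' ∈ s →
    ∃ d, D.assocs[r]? = some d ∧ Fact.inst d.dom o ∈ s ∧ Fact.inst d.img o' ∈ s
  img_mult : ∀ r (d : Association), D.assocs[r]? = some d → ∀ o, Fact.inst d.dom o ∈ s →
    d.imgMult.Allows {o' | Fact.link r o o' ∈ s}
  dom_mult : ∀ r (d : Association), D.assocs[r]? = some d → ∀ o', Fact.inst d.img o' ∈ s →
    d.domMult.Allows {o | Fact.link r o o' ∈ s}
  state : ∀ A ∈ arts, ∀ o, Fact.inst A o ∈ s → ∃! c, D.IsLeaf A c ∧ Fact.inst c o ∈ s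

/-! ### OCL expressions -/

/-- `self` is the artifact instance in scope, `result` the object returned by an operation,
`param i` the `i`-th input of an operation, `it x` an iterator variable. -/
inductive Var : Type
  | self
  | result
  | param (i : ℕ)
  | it (x : ℕ)
  deriving DecidableEq

inductive Kind : Type
  | coll
  | bool

/-- OCL expressions: collections (a single object or string is a one-element collection) and
conditions. A flag `atPre = true` is the suffix `@pre`; `inv = true` navigates an association from
its image to its domain. `collect e x e'` is `e->collect(x | e')`, of which navigation along a path
is a special case; `ex e x φ` is `e->exists(x | φ)`, and `forAll`, `or`, `implies`, `notEmpty` are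
expressed through negation. -/
inductive Expr : Kind → Type
  | var (x : Var) : Expr .coll
  | lit (v : ℕ) : Expr .coll
  | allInstances (c : ℕ) (atPre : Bool) : Expr .coll
  | attr (e : Expr .coll) (a : ℕ) (atPre : Bool) : Expr .coll
  | nav (e : Expr .coll) (r : ℕ) (inv atPre : Bool) : Expr .coll
  | asType (e : Expr .coll) (c : ℕ) : Expr .coll
  | select (e : Expr .coll) (x : ℕ) (φ : Expr .bool) : Expr .coll
  | collect (e : Expr .coll) (x : ℕ) (e' : Expr .coll) : Expr .coll
  | union (e e' : Expr .coll) : Expr .coll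
  | inter (e e' : Expr .coll) : Expr .coll
  | diff (e e' : Expr .coll) : Expr .coll
  | tt : Expr .bool
  | not (φ : Expr .bool) : Expr .bool
  | and (φ ψ : Expr .bool) : Expr .bool
  | eq (e e' : Expr .coll) : Expr .bool
  | includesAll (e e' : Expr .coll) : Expr .bool
  | isEmpty (e : Expr .coll) : Expr .bool
  | ex (e : Expr .coll) (x : ℕ) (φ : Expr .bool) : Expr .bool
  | isNew (e : Expr .coll) : Expr .bool
  | isTypeOf (e : Expr .coll) (c : ℕ) : Expr .bool
  | isKindOf (e : Expr .coll) (c : ℕ) : Expr .bool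

/-- OCL conditions. -/
abbrev Cond := Expr .bool

/-- A partial assignment of values to variables. -/
abbrev Env := Var → Option Val

abbrev Den : Kind → Type
  | .coll => Set Val
  | .bool => Prop

/-- The value of an expression over the class diagram `D`, in the information base `cur`, where
`pre` is the information base before the operation. An undefined variable is the empty
collection. -/
def Expr.eval (D : ClassDiagram) (pre cur : Snapshot) : {k : Kind} → Expr k → Env → Den k
  | _, .var x, ρ => ({v | ρ x = some v} : Set Val)
  | _, .lit v, _ => ({Val.str v} : Set Val)
  | _, .allInstances c t, _ =>
      ({v | ∃ o, v = Val.obj o ∧ Fact.inst c o ∈ bif t then pre else cur} : Set Val)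
  | _, .attr e a t, ρ =>
      ({v | ∃ o w, v = Val.str w ∧ Val.obj o ∈ (e.eval D pre cur ρ : Set Val) ∧
        Fact.attr a o w ∈ bif t then pre else cur} : Set Val)
  | _, .nav e r inv t, ρ =>
      ({v | ∃ o o', v = Val.obj o' ∧ Val.obj o ∈ (e.eval D pre cur ρ : Set Val) ∧
        (bif inv then Fact.link r o' o else Fact.link r o o') ∈ bif t then pre else cur} : Set Val)
  | _, .asType e c, ρ =>
      ({v | v ∈ (e.eval D pre cur ρ : Set Val) ∧ ∃ o, v = Val.obj o ∧ Fact.inst c o ∈ cur} :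
        Set Val)
  | _, .select e x φ, ρ =>
      ({v | v ∈ (e.eval D pre cur ρ : Set Val) ∧
        (φ.eval D pre cur (Function.update ρ (.it x) (some v)) : Prop)} : Set Val)
  | _, .collect e x e', ρ =>
      ({w | ∃ v ∈ (e.eval D pre cur ρ : Set Val),
        w ∈ (e'.eval D pre cur (Function.update ρ (.it x) (some v)) : Set Val)} : Set Val)
  | _, .union e e', ρ => ((e.eval D pre cur ρ : Set Val) ∪ (e'.eval D pre cur ρ : Set Val) : Set Val)
  | _, .inter e e', ρ => ((e.eval D pre cur ρ : Set Val) ∩ (e'.eval D pre cur ρ : Set Val) : Set Val)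
  | _, .diff e e', ρ => ((e.eval D pre cur ρ : Set Val) \ (e'.eval D pre cur ρ : Set Val) : Set Val)
  | _, .tt, _ => True
  | _, .not φ, ρ => ¬ (φ.eval D pre cur ρ : Prop)
  | _, .and φ ψ, ρ => (φ.eval D pre cur ρ : Prop) ∧ (ψ.eval D pre cur ρ : Prop)
  | _, .eq e e', ρ => (e.eval D pre cur ρ : Set Val) = (e'.eval D pre cur ρ : Set Val)
  | _, .includesAll e e', ρ => (e'.eval D pre cur ρ : Set Val) ⊆ (e.eval D pre cur ρ : Set Val)
  | _, .isEmpty e, ρ => (e.eval D pre cur ρ : Set Val) = (∅ : Set Val)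
  | _, .ex e x φ, ρ => ∃ v ∈ (e.eval D pre cur ρ : Set Val),
      (φ.eval D pre cur (Function.update ρ (.it x) (some v)) : Prop)
  | _, .isNew e, ρ => ∃ o, (e.eval D pre cur ρ : Set Val) = {Val.obj o} ∧
      ¬ pre.Live o ∧ cur.Live o
  | _, .isTypeOf e c, ρ => ∃ o, (e.eval D pre cur ρ : Set Val) = {Val.obj o} ∧
      Fact.inst c o ∈ cur ∧ ∀ d, (d, c) ∈ D.isa → Fact.inst d o ∉ cur
  | _, .isKindOf e c, ρ => ∃ o, (e.eval D pre cur ρ : Set Val) = {Val.obj o} ∧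
      Fact.inst c o ∈ cur

/-- Truth of a postcondition, in the information bases before and after the operation. -/
def Cond.HoldsPost (D : ClassDiagram) (pre cur : Snapshot) (φ : Cond) (ρ : Env) : Prop :=
  Expr.eval D pre cur φ ρ

/-- Truth of a condition in one information base. -/
def Cond.Holds (D : ClassDiagram) (s : Snapshot) (φ : Cond) (ρ : Env) : Prop :=
  Expr.eval D s s φ ρ

/-! ### Typing of OCL expressions -/

inductive Ty : Type
  | str
  | cls (c : ℕ)
  | bool

def Ty.Le (D : ClassDiagram) : Ty → Ty → Prop
  | .str, .str => True
  | .cls c, .cls d => D.IsA c d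
  | .bool, .bool => True
  | _, _ => False

/-- `e` is a well-typed expression over `D` that can be given the type `τ` (for a collection, the
type of its elements; a supertype is allowed). Only postconditions (`post = true`) may use `@pre`
and `oclIsNew`. -/
def Expr.HasTy (D : ClassDiagram) (post : Bool) :
    {k : Kind} → Expr k → (Var → Option Ty) → Ty → Prop
  | _, .var x, Γ, τ => ∃ σ, Γ x = some σ ∧ σ.Le D τ
  | _, .lit _, _, τ => τ = .str
  | _, .allInstances c t, _, τ => (t = true → post = true) ∧ c < D.numClasses ∧ Ty.Le D (.cls c) τ
  | _, .attr e a t, Γ, τ => (t = true → post = true) ∧ τ = .str ∧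
      ∃ d, D.attrs[a]? = some d ∧ e.HasTy D post Γ (.cls d.owner)
  | _, .nav e r inv t, Γ, τ => (t = true → post = true) ∧
      ∃ d, D.assocs[r]? = some d ∧
        e.HasTy D post Γ (.cls (bif inv then d.img else d.dom)) ∧
        Ty.Le D (.cls (bif inv then d.dom else d.img)) τ
  | _, .asType e c, Γ, τ => c < D.numClasses ∧ Ty.Le D (.cls c) τ ∧
      ∃ d, e.HasTy D post Γ (.cls d) ∧ D.IsA c d
  | _, .select e x φ, Γ, τ => e.HasTy D post Γ τ ∧
      ∃ σ, e.HasTy D post Γ σ ∧ φ.HasTy D post (Function.update Γ (.it x) (some σ)) .bool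
  | _, .collect e x e', Γ, τ =>
      ∃ σ, e.HasTy D post Γ σ ∧ e'.HasTy D post (Function.update Γ (.it x) (some σ)) τ
  | _, .union e e', Γ, τ => e.HasTy D post Γ τ ∧ e'.HasTy D post Γ τ
  | _, .inter e e', Γ, τ => e.HasTy D post Γ τ ∧ e'.HasTy D post Γ τ
  | _, .diff e e', Γ, τ => e.HasTy D post Γ τ ∧ e'.HasTy D post Γ τ
  | _, .tt, _, τ => τ = .bool
  | _, .not φ, Γ, τ => τ = .bool ∧ φ.HasTy D post Γ .bool
  | _, .and φ ψ, Γ, τ => τ = .bool ∧ φ.HasTy D post Γ .bool ∧ ψ.HasTy D post Γ .bool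
  | _, .eq e e', Γ, τ => τ = .bool ∧ ∃ σ, e.HasTy D post Γ σ ∧ e'.HasTy D post Γ σ
  | _, .includesAll e e', Γ, τ => τ = .bool ∧ ∃ σ, e.HasTy D post Γ σ ∧ e'.HasTy D post Γ σ
  | _, .isEmpty e, Γ, τ => τ = .bool ∧ ∃ σ, e.HasTy D post Γ σ
  | _, .ex e x φ, Γ, τ => τ = .bool ∧
      ∃ σ, e.HasTy D post Γ σ ∧ φ.HasTy D post (Function.update Γ (.it x) (some σ)) .bool
  | _, .isNew e, Γ, τ => τ = .bool ∧ post = true ∧ ∃ d, e.HasTy D post Γ (.cls d)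
  | _, .isTypeOf e c, Γ, τ => τ = .bool ∧ c < D.numClasses ∧
      ∃ d, e.HasTy D post Γ (.cls d) ∧ D.IsA c d
  | _, .isKindOf e c, Γ, τ => τ = .bool ∧ c < D.numClasses ∧
      ∃ d, e.HasTy D post Γ (.cls d) ∧ D.IsA c d

/-! ### Operation contracts, activity diagrams, state transition diagrams, models -/

/-- The operation contract of an atomic task. A parameter is a string (`none`) or an instance of
class `c` (`some c`); its value is supplied by the environment at each execution. The artifact
instance in scope is an implicit further parameter. If `creates`, the task creates and returns the
artifact instance that is in scope from then on. -/
structure Contract where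
  params : List (Option ℕ)
  creates : Bool
  pre : Cond
  post : Cond

/-- Nodes of an activity diagram, with the names of the incoming and outgoing edges: initial node,
atomic task, diamond (decision and merge, with guards on the outgoing edges), bar (fork and join),
activity-final node. -/
inductive Node : Type
  | initial (out : ℕ)
  | task (inn out : ℕ) (K : Contract)
  | choice (ins : List ℕ) (outs : List (ℕ × Cond))
  | bar (ins outs : List ℕ)
  | final (inn : ℕ)

def Node.ins : Node → List ℕ
  | .initial _ => []
  | .task i _ _ => [i]
  | .choice is _ => is
  | .bar is _ => is
  | .final i => [i]

def Node.outs : Node → List ℕ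
  | .initial o => [o]
  | .task _ o _ => [o]
  | .choice _ os => os.map Prod.fst
  | .bar _ os => os
  | .final _ => []

abbrev Activity := List Node

/-- The state transition diagram of the artifact class `artifact`, with initial state `init` and
proper termination state `term`. Its states are the leaves of the hierarchy of the artifact. Its
events are the positions in the list `activities`, which gives the activity diagram of each event.
`initTrans` lists the initial transitions (event, condition), which lead to `init`; `trans` lists
the transitions (source, event, condition, target). -/
structure Chart where
  artifact : ℕ
  init : ℕ
  term : ℕ
  initTrans : List (ℕ × Cond)
  trans : List (ℕ × ℕ × Cond × ℕ)
  activities : List Activity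

/-- A BAUML model: class diagram, OCL constraints, one state transition diagram for each artifact,
and (inside the latter) one activity diagram for each event. The artifacts are the classes that
have a state transition diagram. -/
structure Model where
  diagram : ClassDiagram
  constraints : List Cond
  charts : List Chart

def Model.arts (B : Model) : List ℕ := B.charts.map Chart.artifact

/-! ### Well-formed models -/

/-- Types of the variables in a condition in the scope of an artifact of class `A`. -/
def scopeCtx (A : ℕ) : Var → Option Ty
  | .self => some (.cls A)
  | _ => none

def Contract.ctx (K : Contract) (A : ℕ) (post : Bool) : Var → Option Ty
  | .self => some (.cls A)
  | .result => if K.creates = true ∧ post = true then some (.cls A) else none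
  | .param i => K.params[i]?.map fun p => p.elim Ty.str Ty.cls
  | .it _ => none

structure Contract.WellFormed (D : ClassDiagram) (A : ℕ) (K : Contract) : Prop where
  params_lt : ∀ c, some c ∈ K.params → c < D.numClasses
  pre_typed : Expr.HasTy D false K.pre (K.ctx A false) .bool
  post_typed : Expr.HasTy D true K.post (K.ctx A true) .bool

def Node.WellFormed (D : ClassDiagram) (A : ℕ) : Node → Prop
  | .initial _ => True
  | .task _ _ K => K.WellFormed D A
  | .choice is os => is ≠ [] ∧ os ≠ [] ∧ ∀ p ∈ os, Expr.HasTy D false p.2 (scopeCtx A) .bool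
  | .bar is _ => is ≠ []
  | .final _ => True

/-- There is exactly one initial node, and every edge has exactly one source and one target. -/
structure Activity.WellFormed (D : ClassDiagram) (A : ℕ) (P : Activity) : Prop where
  node : ∀ N ∈ P, N.WellFormed D A
  initial : ∃! i : ℕ, ∃ o, P[i]? = some (Node.initial o)
  outs_nodup : (P.flatMap Node.outs).Nodup
  ins_nodup : (P.flatMap Node.ins).Nodup
  connected : ∀ e, e ∈ P.flatMap Node.outs ↔ e ∈ P.flatMap Node.ins

structure Chart.WellFormed (D : ClassDiagram) (S : Chart) : Prop where
  artifact_lt : S.artifact < D.numClasses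
  artifact_top : ∀ d, (S.artifact, d) ∉ D.isa
  init_leaf : D.IsLeaf S.artifact S.init
  term_leaf : D.IsLeaf S.artifact S.term
  initTrans : ∀ p ∈ S.initTrans, p.1 < S.activities.length ∧
    Expr.HasTy D false p.2 (fun _ => none) .bool
  trans : ∀ t ∈ S.trans, D.IsLeaf S.artifact t.1 ∧ t.2.1 < S.activities.length ∧
    Expr.HasTy D false t.2.2.1 (scopeCtx S.artifact) .bool ∧ D.IsLeaf S.artifact t.2.2.2
  activity : ∀ P ∈ S.activities, Activity.WellFormed D S.artifact P
  /-- Artifact instances are created in the activity diagrams of initial transitions only. -/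
  creates : ∀ t ∈ S.trans, ∀ P, S.activities[t.2.1]? = some P →
    ∀ i o K, Node.task i o K ∈ P → K.creates = false

/-- The empty environment. -/
def emptyEnv : Env := fun _ => none

structure Model.WellFormed (B : Model) : Prop where
  diagram : B.diagram.WellFormed
  constraints : ∀ φ ∈ B.constraints, Expr.HasTy B.diagram false φ (fun _ => none) .bool
  /-- The initial (empty) information base satisfies the constraints. -/
  constraints_empty : ∀ φ ∈ B.constraints, Cond.Holds B.diagram ∅ φ emptyEnv
  charts : ∀ S ∈ B.charts, S.WellFormed B.diagram
  /-- There is one state transition diagram per artifact. -/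
  arts_nodup : B.arts.Nodup
  /-- Different artifacts have disjoint hierarchies. -/
  arts_disjoint : ∀ A ∈ B.arts, ∀ A' ∈ B.arts, ∀ c,
    B.diagram.IsA c A → B.diagram.IsA c A' → A = A'

/-! ### Execution -/

/-- A running activity: the activity diagram `act` is executed for a transition with target state
`target` of an artifact of class `artifact`; `self` is the artifact instance in scope (`none` until
the instance has been created), `marking` the multiset of edges that carry a token. -/
structure Run where
  artifact : ℕ
  act : Activity
  target : ℕ
  self : Option ℕ
  marking : Multiset ℕ

/-- A state of the system: the information base and the running activities. -/
structure Config where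
  snap : Snapshot
  runs : Multiset Run

/-- The environment in which only the artifact instance in scope is defined. -/
def scopeEnv (self : Option ℕ) : Env
  | .self => self.map Val.obj
  | _ => none

def taskEnv (self result : Option ℕ) (args : List Val) : Env
  | .self => self.map Val.obj
  | .result => result.map Val.obj
  | .param i => args[i]?
  | .it _ => none

/-- `v` is a possible input for a parameter: a string, or an instance of the given class. -/
def ArgOk (s : Snapshot) : Option ℕ → Val → Prop
  | none, v => ∃ w, v = Val.str w
  | some c, v => ∃ o, v = Val.obj o ∧ Fact.inst c o ∈ s

/-- Two readings of a postcondition. `permissive`: the task may lead to every legal information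
base that satisfies it. `inertial`: moreover the information base changes no more than it has to,
i.e., the set of changed facts is minimal with respect to inclusion. -/
inductive FrameRule : Type
  | permissive
  | inertial

/-- `s'` is a legal information base that satisfies the constraints of the model and, with respect
to `s`, the postcondition of `K`; the returned artifact instance, if any, exists in it. -/
def Contract.Post (B : Model) (A : ℕ) (K : Contract) (self result : Option ℕ) (args : List Val)
    (s s' : Snapshot) : Prop :=
  s'.Legal B.diagram B.arts ∧
  (∀ φ ∈ B.constraints, Cond.Holds B.diagram s' φ emptyEnv) ∧
  (∀ r ∈ result, Fact.inst A r ∈ s') ∧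
  Cond.HoldsPost B.diagram s s' K.post (taskEnv self result args)

def Contract.Effect (B : Model) (fr : FrameRule) (A : ℕ) (K : Contract) (self result : Option ℕ)
    (args : List Val) (s s' : Snapshot) : Prop :=
  K.Post B A self result args s s' ∧
  (fr = .inertial → ∀ s'' : Snapshot, K.Post B A self result args s s'' →
    symmDiff s s'' ⊆ symmDiff s s' → s'' = s')

/-- The task with contract `K`, executed with the artifact instance `self` (of class `A`) in scope
and with some inputs, leads from `s` to `s'` and leaves `self'` in scope. -/
def Contract.Exec (B : Model) (fr : FrameRule) (A : ℕ) (K : Contract) (self self' : Option ℕ)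
    (s s' : Snapshot) : Prop :=
  (∀ o ∈ self, Fact.inst A o ∈ s) ∧
  ∃ args : List Val, List.Forall₂ (ArgOk s) K.params args ∧
    Cond.Holds B.diagram s K.pre (taskEnv self none args) ∧
    ((K.creates = false ∧ self' = self ∧ K.Effect B fr A self none args s s') ∨
     (K.creates = true ∧ self = none ∧
       ∃ r, ¬ s.Live r ∧ self' = some r ∧ K.Effect B fr A none (some r) args s s'))

/-- One step of the system. Activities of different artifact instances are interleaved; an artifact
instance takes part in at most one transition at a time. -/
inductive Step (B : Model) (fr : FrameRule) : Config → Config → Prop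
  /-- An initial transition is started. -/
  | launch {s : Snapshot} {R : Multiset Run} {S : Chart} {ε e : ℕ} {φ : Cond} {P : Activity}
      (hS : S ∈ B.charts) (ht : (ε, φ) ∈ S.initTrans) (hP : S.activities[ε]? = some P)
      (hφ : Cond.Holds B.diagram s φ emptyEnv) (he : Node.initial e ∈ P) :
      Step B fr ⟨s, R⟩ ⟨s, ⟨S.artifact, P, S.init, none, {e}⟩ ::ₘ R⟩
  /-- A transition is started for an artifact instance that is in its source state. -/
  | start {s : Snapshot} {R : Multiset Run} {S : Chart} {v ε v' e o : ℕ} {φ : Cond} {P : Activity}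
      (hS : S ∈ B.charts) (ht : (v, ε, φ, v') ∈ S.trans) (hP : S.activities[ε]? = some P)
      (hA : Fact.inst S.artifact o ∈ s) (hv : Fact.inst v o ∈ s)
      (hidle : ∀ p ∈ R, p.self ≠ some o)
      (hφ : Cond.Holds B.diagram s φ (scopeEnv (some o))) (he : Node.initial e ∈ P) :
      Step B fr ⟨s, R⟩ ⟨s, ⟨S.artifact, P, v', some o, {e}⟩ ::ₘ R⟩
  | task {s s' : Snapshot} {R : Multiset Run} {A t i o : ℕ} {P : Activity}
      {self self' : Option ℕ} {m : Multiset ℕ} {K : Contract}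
      (hN : Node.task i o K ∈ P) (hK : K.Exec B fr A self self' s s')
      (hfresh : ∀ r ∈ self', ∀ p ∈ R, p.self ≠ some r) :
      Step B fr ⟨s, ⟨A, P, t, self, i ::ₘ m⟩ ::ₘ R⟩ ⟨s', ⟨A, P, t, self', o ::ₘ m⟩ ::ₘ R⟩
  | choice {s : Snapshot} {R : Multiset Run} {A t i o : ℕ} {P : Activity}
      {self : Option ℕ} {m : Multiset ℕ} {is : List ℕ} {os : List (ℕ × Cond)} {φ : Cond}
      (hN : Node.choice is os ∈ P) (hi : i ∈ is) (ho : (o, φ) ∈ os)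
      (hφ : Cond.Holds B.diagram s φ (scopeEnv self)) :
      Step B fr ⟨s, ⟨A, P, t, self, i ::ₘ m⟩ ::ₘ R⟩ ⟨s, ⟨A, P, t, self, o ::ₘ m⟩ ::ₘ R⟩
  | bar {s : Snapshot} {R : Multiset Run} {A t : ℕ} {P : Activity}
      {self : Option ℕ} {m : Multiset ℕ} {is os : List ℕ} (hN : Node.bar is os ∈ P) :
      Step B fr ⟨s, ⟨A, P, t, self, (is : Multiset ℕ) + m⟩ ::ₘ R⟩
        ⟨s, ⟨A, P, t, self, (os : Multiset ℕ) + m⟩ ::ₘ R⟩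
  /-- The activity ends, and with it the transition; the instance must be in the target state. -/
  | finish {s : Snapshot} {R : Multiset Run} {A t i o : ℕ} {P : Activity} {m : Multiset ℕ}
      (hN : Node.final i ∈ P) (ht : Fact.inst t o ∈ s) :
      Step B fr ⟨s, ⟨A, P, t, some o, i ::ₘ m⟩ ::ₘ R⟩ ⟨s, R⟩

/-- The system starts from the empty information base, with no running activity. -/
def initialConfig : Config := ⟨∅, 0⟩

/-! ### Artifact termination -/

/-- The states that satisfy `μY. T(x) ∨ (A(x) ∧ ⟨-⟩Y)`. -/
def reachesTerm (B : Model) (fr : FrameRule) (A T x : ℕ) : Set Config :=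
  OrderHom.lfp
    { toFun := fun Y => {c | Fact.inst T x ∈ c.snap ∨
        (Fact.inst A x ∈ c.snap ∧ ∃ c', Step B fr c c' ∧ c' ∈ Y)}
      monotone' := by
        rintro Y Y' hY c (h | ⟨h, c', hc, hc'⟩)
        · exact Or.inl h
        · exact Or.inr ⟨h, c', hc, hY hc'⟩ }

/-- The states that satisfy the artifact termination property
`νZ. (⋀_A ∀ x. A(x) → μY. T_A(x) ∨ (A(x) ∧ ⟨-⟩Y)) ∧ [-]Z`. -/
def terminationProperty (B : Model) (fr : FrameRule) : Set Config :=
  OrderHom.gfp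
    { toFun := fun Z => {c | (∀ S ∈ B.charts, ∀ x, Fact.inst S.artifact x ∈ c.snap →
        c ∈ reachesTerm B fr S.artifact S.term x) ∧ ∀ c', Step B fr c c' → c' ∈ Z}
      monotone' := by
        rintro Z Z' hZ c ⟨h, hc⟩
        exact ⟨h, fun c' hc' => hZ (hc c' hc')⟩ }

/-- The model satisfies the artifact termination property. -/
def Model.Terminates (B : Model) (fr : FrameRule) : Prop :=
  initialConfig ∈ terminationProperty B fr

/-! ### Models as natural numbers

The inputs of a decision procedure are the code numbers of models. -/

open Encodable

def Var.code : Var → ℕ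
  | .self => Nat.pair 0 0
  | .result => Nat.pair 1 0
  | .param i => Nat.pair 2 i
  | .it x => Nat.pair 3 x

def Expr.code : {k : Kind} → Expr k → ℕ
  | _, .var x => Nat.pair 0 x.code
  | _, .lit v => Nat.pair 1 v
  | _, .allInstances c t => Nat.pair 2 (encode (c, t))
  | _, .attr e a t => Nat.pair 3 (encode (e.code, a, t))
  | _, .nav e r inv t => Nat.pair 4 (encode (e.code, r, inv, t))
  | _, .asType e c => Nat.pair 5 (encode (e.code, c))
  | _, .select e x φ => Nat.pair 6 (encode (e.code, x, φ.code))
  | _, .collect e x e' => Nat.pair 7 (encode (e.code, x, e'.code))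
  | _, .union e e' => Nat.pair 8 (encode (e.code, e'.code))
  | _, .inter e e' => Nat.pair 9 (encode (e.code, e'.code))
  | _, .diff e e' => Nat.pair 10 (encode (e.code, e'.code))
  | _, .tt => Nat.pair 11 0
  | _, .not φ => Nat.pair 12 φ.code
  | _, .and φ ψ => Nat.pair 13 (encode (φ.code, ψ.code))
  | _, .eq e e' => Nat.pair 14 (encode (e.code, e'.code))
  | _, .includesAll e e' => Nat.pair 15 (encode (e.code, e'.code))
  | _, .isEmpty e => Nat.pair 16 e.code
  | _, .ex e x φ => Nat.pair 17 (encode (e.code, x, φ.code))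
  | _, .isNew e => Nat.pair 18 e.code
  | _, .isTypeOf e c => Nat.pair 19 (encode (e.code, c))
  | _, .isKindOf e c => Nat.pair 20 (encode (e.code, c))

def Attribute.code (a : Attribute) : ℕ := encode (a.owner, a.isBool)

def Mult.code (m : Mult) : ℕ := encode (m.lo, m.hi)

def Association.code (r : Association) : ℕ :=
  encode (r.dom, r.img, r.domMult.code, r.imgMult.code)

def ClassDiagram.code (D : ClassDiagram) : ℕ :=
  encode (D.numClasses, D.isa, D.attrs.map Attribute.code, D.assocs.map Association.code)

def Contract.code (K : Contract) : ℕ := encode (K.params, K.creates, K.pre.code, K.post.code)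

def Node.code : Node → ℕ
  | .initial o => Nat.pair 0 o
  | .task i o K => Nat.pair 1 (encode (i, o, K.code))
  | .choice is os => Nat.pair 2 (encode (is, os.map fun p => (p.1, Expr.code p.2)))
  | .bar is os => Nat.pair 3 (encode (is, os))
  | .final i => Nat.pair 4 i

def Activity.code (P : Activity) : ℕ := encode (P.map Node.code)

def Chart.code (S : Chart) : ℕ :=
  encode (S.artifact, S.init, S.term, S.initTrans.map (fun p => (p.1, Expr.code p.2)),
    S.trans.map (fun t => (t.1, t.2.1, Expr.code t.2.2.1, t.2.2.2)),
    S.activities.map Activity.code)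

def Model.code (B : Model) : ℕ :=
  encode (B.diagram.code, B.constraints.map Expr.code, B.charts.map Chart.code)

/-! Different models have different codes. -/

theorem Var.code_injective : Function.Injective Var.code := by
  intro x y h
  cases x <;> cases y <;> simp_all [Var.code, Nat.pair_eq_pair]

theorem Expr.code_injective {k : Kind} : Function.Injective (Expr.code : Expr k → ℕ) := by
  intro e
  induction e with
  | var x =>
    intro e' h
    cases e' <;> simp only [Expr.code, Nat.pair_eq_pair] at h <;> first
      | omega
      | rw [Var.code_injective h.2]
  | _ =>
    intro e' h
    cases e' <;> simp only [Expr.code, Nat.pair_eq_pair, encode_inj, Prod.mk.injEq] at h <;> first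
      | omega
      | grind

theorem Attribute.code_injective : Function.Injective Attribute.code := by
  rintro ⟨⟩ ⟨⟩ h
  simpa [Attribute.code] using h

theorem Mult.code_injective : Function.Injective Mult.code := by
  rintro ⟨⟩ ⟨⟩ h
  simpa [Mult.code] using h

theorem Association.code_injective : Function.Injective Association.code := by
  rintro ⟨⟩ ⟨⟩ h
  simpa [Association.code, Mult.code_injective.eq_iff] using h

theorem ClassDiagram.code_injective : Function.Injective ClassDiagram.code := by
  rintro ⟨⟩ ⟨⟩ h
  simpa [ClassDiagram.code, (List.map_injective_iff.2 Attribute.code_injective).eq_iff,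
    (List.map_injective_iff.2 Association.code_injective).eq_iff] using h

theorem Contract.code_injective : Function.Injective Contract.code := by
  rintro ⟨⟩ ⟨⟩ h
  simpa [Contract.code, Expr.code_injective.eq_iff] using h

theorem guarded_injective :
    Function.Injective fun p : ℕ × Cond => (p.1, Expr.code p.2) := by
  rintro ⟨⟩ ⟨⟩ h
  simpa [Expr.code_injective.eq_iff] using h

theorem Node.code_injective : Function.Injective Node.code := by
  intro M N h
  cases M <;> cases N <;> simp only [Node.code, Nat.pair_eq_pair] at h <;> first
    | omega
    | simpa [Contract.code_injective.eq_iff,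
        (List.map_injective_iff.2 guarded_injective).eq_iff] using h

theorem Activity.code_injective : Function.Injective Activity.code :=
  encode_injective.comp (List.map_injective_iff.2 Node.code_injective)

theorem Chart.code_injective : Function.Injective Chart.code := by
  have ht : Function.Injective
      fun t : ℕ × ℕ × Cond × ℕ => (t.1, t.2.1, Expr.code t.2.2.1, t.2.2.2) := by
    rintro ⟨_, _, _, _⟩ ⟨_, _, _, _⟩ h
    simpa [Expr.code_injective.eq_iff] using h
  rintro ⟨⟩ ⟨⟩ h
  simpa [Chart.code, (List.map_injective_iff.2 guarded_injective).eq_iff,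
    (List.map_injective_iff.2 ht).eq_iff,
    (List.map_injective_iff.2 Activity.code_injective).eq_iff] using h

theorem Model.code_injective : Function.Injective Model.code := by
  rintro ⟨⟩ ⟨⟩ h
  simpa [Model.code, ClassDiagram.code_injective.eq_iff,
    (List.map_injective_iff.2 Expr.code_injective).eq_iff,
    (List.map_injective_iff.2 Chart.code_injective).eq_iff] using h

end BAUML

/-! The halting problem reduces to artifact termination. Fix a code `c` of a partial recursive
function with undecidable domain. For each `n` there is a model with one artifact, whose instances
are created in one state and may pass to the termination state, all guards being trivial. The only
obstacle is a single OCL constraint: the termination state is empty unless the information base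
contains, on a separate class with binary associations, a computation of `c` at `n`. The
postconditions do not mention this class, so one task can write any finite structure there; no
machine is simulated step by step.

"Contains a computation" is a first-order sentence about finite structures. It asks for a linear
order with partial successor and zero relations, and for the components of the pairing function;
these need neither addition nor multiplication, because `Nat.unpair` runs through the pairs by a
local rule (`unpair_succ`). For each subcode there is a relation whose pairs must be justified by
other pairs, as the definition of the function prescribes. In a finite structure every element can
be valued by the number of its predecessors, and then every justified pair is a true value
(`IsSegment.mem_eval_of_graph`, `dom_of_holds`). Conversely, a computation with step bound `k` fits
into a finite initial segment (`rule_of_std`, `holds_of_std`).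

If `c` is undefined at `n`, an instance can be created but the termination state stays empty
forever. If `c` is defined at `n`, every instance in any configuration whatsoever can be closed: a
fresh instance is created and runs a task that closes all instances at once (`mem_reachesTerm`).
Both readings of postconditions are covered, since a satisfiable postcondition always has a result
of minimal change (`Contract.exists_effect`) and only the postcondition is used afterwards. Finally,
`n` enters the model through one expression, so the code of the model is primitive recursive in `n`.
-/

namespace BAUML

open Nat.Partrec (Code)
open Encodable

/-! ### Finite initial segments of arithmetic

A finite structure with binary relations `q 0, q 1, …` on a set `W` of natural numbers (used as
mere names). The first five relations describe an initial segment of the natural numbers, with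
order, successor, zero and the two components of the pairing function; the relation `graph c` is a
part of the graph of the partial recursive function with code `c`. -/

namespace Arith

abbrev lt : ℕ := 0
abbrev succ : ℕ := 1
abbrev zero : ℕ := 2
abbrev left : ℕ := 3
abbrev right : ℕ := 4
abbrev graph (c : Code) : ℕ := encode c + 5

/-- `(a, b)` follows `(a', b')` in the order in which `Nat.unpair` enumerates the pairs. -/
def Next (q : ℕ → ℕ → ℕ → Prop) (a' b' a b : ℕ) : Prop :=
  (q succ a' a ∧ q lt a b' ∧ b = b') ∨ (q succ a' b' ∧ a = b' ∧ q zero b b) ∨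
  (q lt b' a' ∧ a = a' ∧ q succ b' b) ∨ (a' = b' ∧ q zero a a ∧ q succ a' b)

/-- Associations are binary, so the unary predicate "zero" is read off the diagonal of `q zero`. The
axioms on successor and zero only restrict these relations; they do not ask that successors exist,
so finite models are possible. -/
structure IsSegment (W : Set ℕ) (q : ℕ → ℕ → ℕ → Prop) : Prop where
  irrefl : ∀ a ∈ W, ¬ q lt a a
  trans : ∀ a ∈ W, ∀ b ∈ W, ∀ c ∈ W, q lt a b → q lt b c → q lt a c
  total : ∀ a ∈ W, ∀ b ∈ W, a = b ∨ q lt a b ∨ q lt b a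
  succ_spec : ∀ a ∈ W, ∀ b ∈ W, q succ a b → q lt a b ∧ ¬ ∃ c ∈ W, q lt a c ∧ q lt c b
  zero_spec : ∀ a ∈ W, q zero a a → ¬ ∃ b ∈ W, q lt b a
  left_total : ∀ n ∈ W, ∃ a ∈ W, q left n a
  right_total : ∀ n ∈ W, ∃ a ∈ W, q right n a
  unpair : ∀ n ∈ W, ∀ a ∈ W, ∀ b ∈ W, q left n a ∧ q right n b →
    (q zero n n ∧ q zero a a ∧ q zero b b) ∨ ∃ n' ∈ W, ∃ a' ∈ W, ∃ b' ∈ W,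
      q succ n' n ∧ q left n' a' ∧ q right n' b' ∧ Next q a' b' a b

/-- What has to hold for a pair `(a, b)` in the relation `graph c`. -/
def Rule (W : Set ℕ) (q : ℕ → ℕ → ℕ → Prop) (c : Code) (a b : ℕ) : Prop :=
  match c with
  | .zero => q zero b b
  | .succ => q succ a b
  | .left => q left a b
  | .right => q right a b
  | .pair f g => ∃ x ∈ W, ∃ y ∈ W, q (graph f) a x ∧ q (graph g) a y ∧ q left b x ∧ q right b y
  | .comp f g => ∃ x ∈ W, q (graph g) a x ∧ q (graph f) x b
  | .prec f g => ∃ x ∈ W, ∃ y ∈ W, q left a x ∧ q right a y ∧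
      ((q zero y y ∧ q (graph f) x b) ∨
        ∃ z ∈ W, ∃ p ∈ W, ∃ i ∈ W, ∃ r ∈ W, ∃ t ∈ W, q succ z y ∧ q left p x ∧ q right p z ∧
          q (graph (.prec f g)) p i ∧ q left r z ∧ q right r i ∧ q left t x ∧ q right t r ∧
          q (graph g) t b)
  | .rfind' f => ∃ x ∈ W, q (graph f) a x ∧
      ((q zero x x ∧ q right a b) ∨
        ∃ d ∈ W, ∃ z ∈ W, ∃ m ∈ W, ∃ m' ∈ W, ∃ p ∈ W, q succ d x ∧ q left a z ∧ q right a m ∧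
          q succ m m' ∧ q left p z ∧ q right p m' ∧ q (graph (.rfind' f)) p b)

/-- The rules for `c` and its subcodes. -/
def Rules (W : Set ℕ) (q : ℕ → ℕ → ℕ → Prop) (c : Code) : Prop :=
  (∀ a ∈ W, ∀ b ∈ W, q (graph c) a b → Rule W q c a b) ∧
  match c with
  | .pair f g | .comp f g | .prec f g => Rules W q f ∧ Rules W q g
  | .rfind' f => Rules W q f
  | .zero | .succ | .left | .right => True

/-! #### Soundness -/

open Classical in
/-- The number named by `a`. -/
noncomputable def value (W : Finset ℕ) (q : ℕ → ℕ → ℕ → Prop) (a : ℕ) : ℕ :=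
  (W.filter fun b => q lt b a).card

/-- `Nat.pair` fills square shells: the shell with maximum `m` is `(0, m), …, (m - 1, m), (m, 0), …,
(m, m)`. The four cases are a step along the first leg, the turn, a step along the second leg, and
the passage to the next shell; they match the disjuncts of `Next`. -/
theorem unpair_succ (n : ℕ) : (n + 1).unpair =
    if n.unpair.1 < n.unpair.2 then
      if n.unpair.1 + 1 < n.unpair.2 then (n.unpair.1 + 1, n.unpair.2) else (n.unpair.2, 0)
    else if n.unpair.2 < n.unpair.1 then (n.unpair.1, n.unpair.2 + 1) else (0, n.unpair.1 + 1) := by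
  obtain ⟨⟨a, b⟩, rfl⟩ : ∃ p : ℕ × ℕ, n = Nat.pair p.1 p.2 := ⟨n.unpair, (Nat.pair_unpair n).symm⟩
  simp only [Nat.unpair_pair]
  rw [← Nat.pairEquiv_symm_apply, Equiv.symm_apply_eq, Nat.pairEquiv_apply]
  rcases lt_trichotomy a b with h | rfl | h
  · rw [if_pos h]
    split_ifs with h'
    · simp [Function.uncurry, Nat.pair, h, h', Nat.add_assoc]
    · obtain rfl : b = a + 1 := by omega
      simp [Function.uncurry, Nat.pair]
      ring
  · simp [Function.uncurry, Nat.pair]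
    ring
  · simp only [Function.uncurry, Nat.pair]
    split_ifs <;> first | omega | ring

section

variable {W : Finset ℕ} {q : ℕ → ℕ → ℕ → Prop}

theorem value_le_card (a : ℕ) : value W q a ≤ W.card := by
  classical exact Finset.card_filter_le _ _

theorem IsSegment.value_zero (h : IsSegment W q) {a : ℕ} (ha : a ∈ W) (hz : q zero a a) :
    value W q a = 0 := by
  classical
  rw [value, Finset.card_eq_zero, Finset.filter_eq_empty_iff]
  exact fun b hb hl => h.zero_spec a ha hz ⟨b, hb, hl⟩

/-- By totality and the absence of elements in between, the predecessors of `b` are `a` and the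
predecessors of `a`. -/
theorem IsSegment.value_succ (h : IsSegment W q) {a b : ℕ} (ha : a ∈ W) (hb : b ∈ W)
    (hs : q succ a b) : value W q b = value W q a + 1 := by
  classical
  obtain ⟨hab, hn⟩ := h.succ_spec a ha b hb hs
  have hnot : a ∉ W.filter fun c => q lt c a := by
    simp [h.irrefl a ha]
  rw [value, value, ← Finset.card_insert_of_notMem hnot]
  congr 1
  ext c
  simp only [Finset.mem_filter, Finset.mem_insert]
  constructor
  · rintro ⟨hc, hcb⟩
    rcases h.total c hc a ha with rfl | hca | hac
    · exact Or.inl rfl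
    · exact Or.inr ⟨hc, hca⟩
    · exact (hn ⟨c, hc, hac, hcb⟩).elim
  · rintro (rfl | ⟨hc, hca⟩)
    · exact ⟨ha, hab⟩
    · exact ⟨hc, h.trans c hc a ha b hb hca hab⟩

theorem IsSegment.value_lt (h : IsSegment W q) {a b : ℕ} (ha : a ∈ W) (hb : b ∈ W)
    (hl : q lt a b) : value W q a < value W q b := by
  classical
  refine Finset.card_lt_card (Finset.ssubset_iff_of_subset ?_ |>.2 ⟨a, ?_, ?_⟩)
  · intro c
    simp only [Finset.mem_filter]
    exact fun ⟨hc, hca⟩ => ⟨hc, h.trans c hc a ha b hb hca hl⟩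
  · simp [ha, hl]
  · simp [h.irrefl a ha]

/-- Induction on the value of `n`: the axiom `unpair` leads to the predecessor of `n`, and `Next` is
the recursion of `unpair_succ`. -/
theorem IsSegment.unpair_value (h : IsSegment W q) {n a b : ℕ} (hn : n ∈ W) (ha : a ∈ W)
    (hb : b ∈ W) (hl : q left n a) (hr : q right n b) :
    (value W q n).unpair = (value W q a, value W q b) := by
  induction hk : value W q n generalizing n a b with
  | zero =>
    rcases h.unpair n hn a ha b hb ⟨hl, hr⟩ with ⟨-, hza, hzb⟩ | ⟨n', hn', _, _, _, _, hs, _⟩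
    · rw [h.value_zero ha hza, h.value_zero hb hzb, Nat.unpair_zero]
      rfl
    · rw [h.value_succ hn' hn hs] at hk
      omega
  | succ k ih =>
    rcases h.unpair n hn a ha b hb ⟨hl, hr⟩ with
      ⟨hz, -⟩ | ⟨n', hn', a', ha', b', hb', hs, hl', hr', hnext⟩
    · rw [h.value_zero hn hz] at hk
      omega
    · rw [h.value_succ hn' hn hs] at hk
      rw [unpair_succ, ih hn' ha' hb' hl' hr' (by omega)]
      rcases hnext with ⟨h1, h2, rfl⟩ | ⟨h1, rfl, h2⟩ | ⟨h1, rfl, h2⟩ | ⟨rfl, h1, h2⟩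
      · have e1 := h.value_succ ha' ha h1
        have e2 := h.value_lt ha hb' h2
        rw [if_pos (by omega), if_pos (by omega)]
        simp [e1]
      · have e1 := h.value_succ ha' hb' h1
        rw [if_pos (by omega), if_neg (by omega), h.value_zero hb h2]
      · have e1 := h.value_lt hb' ha' h1
        rw [if_neg (by omega), if_pos (by omega), h.value_succ hb' hb h2]
      · rw [if_neg (by omega), if_neg (by omega), h.value_zero ha h1, h.value_succ ha' hb h2]

/-- The recursion determines both components jointly, so the other one has to be supplied by
totality. -/
theorem IsSegment.value_left (h : IsSegment W q) {n a : ℕ} (hn : n ∈ W) (ha : a ∈ W)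
    (hl : q left n a) : (value W q n).unpair.1 = value W q a := by
  obtain ⟨b, hb, hr⟩ := h.right_total n hn
  rw [h.unpair_value hn ha hb hl hr]

theorem IsSegment.value_right (h : IsSegment W q) {n b : ℕ} (hn : n ∈ W) (hb : b ∈ W)
    (hr : q right n b) : (value W q n).unpair.2 = value W q b := by
  obtain ⟨a, ha, hl⟩ := h.left_total n hn
  rw [h.unpair_value hn ha hb hl hr]

theorem IsSegment.value_pair (h : IsSegment W q) {n a b : ℕ} (hn : n ∈ W) (ha : a ∈ W)
    (hb : b ∈ W) (hl : q left n a) (hr : q right n b) :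
    value W q n = Nat.pair (value W q a) (value W q b) := by
  rw [← h.value_left hn ha hl, ← h.value_right hn hb hr, Nat.pair_unpair]

/-- The step-bounded evaluator `evaln` treats `rfind'` by recursion on the counter, which has the
shape of `Rule`; hence the detour through it. -/
theorem mem_eval_rfind'_zero {f : Code} {a m : ℕ} (h : 0 ∈ f.eval (Nat.pair a m)) :
    m ∈ (Code.rfind' f).eval (Nat.pair a m) := by
  obtain ⟨k, hk⟩ := Code.evaln_complete.1 h
  obtain _ | k := k
  · simp [Code.evaln] at hk
  refine Code.evaln_complete.2 ⟨k + 1, ?_⟩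
  have := Code.evaln_bound hk
  simp only [Option.mem_def] at hk
  simp [Code.evaln, Nat.le_of_lt_succ this, hk]

theorem mem_eval_rfind'_succ {f : Code} {a m x b : ℕ} (h : x + 1 ∈ f.eval (Nat.pair a m))
    (hb : b ∈ (Code.rfind' f).eval (Nat.pair a (m + 1))) :
    b ∈ (Code.rfind' f).eval (Nat.pair a m) := by
  obtain ⟨k, hk⟩ := Code.evaln_complete.1 h
  obtain ⟨l, hl⟩ := Code.evaln_complete.1 hb
  -- With fuel `max k l + 1`, the test of `f` uses the full fuel and the recursive call one unit
  -- less.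
  replace hk := Code.evaln_mono ((le_max_left k l).trans (Nat.le_succ _)) hk
  replace hl := Code.evaln_mono (le_max_right k l) hl
  refine Code.evaln_complete.2 ⟨max k l + 1, ?_⟩
  have := Code.evaln_bound hk
  simp only [Option.mem_def] at hk hl
  simp [Code.evaln, Nat.le_of_lt_succ this, hk, hl]

/-- Structural induction on `c`. For `prec` and `rfind'` a pair is justified by a pair of the same
relation, and an inner induction shows that this is not circular. -/
theorem IsSegment.mem_eval_of_graph (h : IsSegment W q) (c : Code) (hc : Rules W q c) {a b : ℕ}
    (ha : a ∈ W) (hb : b ∈ W) (hab : q (graph c) a b) :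
    value W q b ∈ c.eval (value W q a) := by
  induction c generalizing a b with
  | zero =>
    rw [Rules] at hc
    simp [Code.eval, pure, PFun.pure, h.value_zero hb (hc.1 a ha b hb hab)]
  | succ =>
    rw [Rules] at hc
    simp [Code.eval, h.value_succ ha hb (hc.1 a ha b hb hab)]
  | left =>
    rw [Rules] at hc
    simp [Code.eval, h.value_left ha hb (hc.1 a ha b hb hab)]
  | right =>
    rw [Rules] at hc
    simp [Code.eval, h.value_right ha hb (hc.1 a ha b hb hab)]
  | pair f g hf hg =>
    rw [Rules] at hc
    obtain ⟨hr, hcf, hcg⟩ := hc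
    obtain ⟨x, hx, y, hy, h1, h2, h3, h4⟩ := hr a ha b hb hab
    have e1 := hf hcf ha hx h1
    have e2 := hg hcg ha hy h2
    simp only [Code.eval, Seq.seq, Part.map_eq_map, Part.mem_bind_iff, Part.mem_map_iff]
    exact ⟨_, ⟨_, e1, rfl⟩, _, e2, (h.value_pair hb hx hy h3 h4).symm⟩
  | comp f g hf hg =>
    rw [Rules] at hc
    obtain ⟨hr, hcf, hcg⟩ := hc
    obtain ⟨x, hx, h1, h2⟩ := hr a ha b hb hab
    exact Part.mem_bind_iff.2 ⟨_, hg hcg ha hx h1, hf hcf hx hb h2⟩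
  | prec f g hf hg =>
    rw [Rules] at hc
    obtain ⟨hr, hcf, hcg⟩ := hc
    -- The recursion argument, the second component, decreases with each justification.
    suffices ∀ k a b, a ∈ W → b ∈ W → q (graph (.prec f g)) a b → (value W q a).unpair.2 = k →
        value W q b ∈ (Code.prec f g).eval (value W q a) from this _ a b ha hb hab rfl
    intro k
    induction k with
    | zero =>
      intro a b ha hb hab hk
      obtain ⟨x, hx, y, hy, h1, h2, ⟨h3, h4⟩ | ⟨z, hz, _, _, _, _, _, _, _, _, h3, _⟩⟩ :=
        hr a ha b hb hab
      · rw [h.value_pair ha hx hy h1 h2, h.value_zero hy h3, Code.eval_prec_zero]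
        exact hf hcf hx hb h4
      · rw [h.value_right ha hy h2, h.value_succ hz hy h3] at hk
        omega
    | succ k ih =>
      intro a b ha hb hab hk
      obtain ⟨x, hx, y, hy, h1, h2, ⟨h3, h4⟩ |
        ⟨z, hz, p, hp, i, hi, r, hr', t, ht, h3, h4, h5, h6, h7, h8, h9, h10, h11⟩⟩ :=
        hr a ha b hb hab
      · rw [h.value_right ha hy h2, h.value_zero hy h3] at hk
        omega
      · rw [h.value_right ha hy h2, h.value_succ hz hy h3] at hk
        have e1 := ih p i hp hi h6 (by rw [h.value_right hp hz h5]; omega)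
        have e2 := hg hcg ht hb h11
        rw [h.value_pair hp hx hz h4 h5] at e1
        rw [h.value_pair ht hx hr' h9 h10, h.value_pair hr' hz hi h7 h8] at e2
        rw [h.value_pair ha hx hy h1 h2, h.value_succ hz hy h3, Code.eval_prec_succ,
          Part.bind_eq_bind, Part.mem_bind_iff]
        exact ⟨_, e1, e2⟩
  | rfind' f hf =>
    rw [Rules] at hc
    obtain ⟨hr, hcf⟩ := hc
    -- Here the counter increases, but it is the value of an element of `W` and so at most `W.card`.
    -- The induction is on a bound `k` for the remaining room; for `k = 0` no larger counter exists.
    suffices ∀ k a b, a ∈ W → b ∈ W → q (graph (.rfind' f)) a b →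
        W.card ≤ k + (value W q a).unpair.2 →
        value W q b ∈ (Code.rfind' f).eval (value W q a) from
      this W.card a b ha hb hab (Nat.le_add_right _ _)
    intro k
    induction k with
    | zero =>
      intro a b ha hb hab hk
      obtain ⟨x, hx, h1, ⟨h2, h3⟩ | ⟨d, hd, z, hz, m, hm, m', hm', p, hp, h2, h3, h4, h5, -⟩⟩ :=
        hr a ha b hb hab
      · have e := hf hcf ha hx h1
        obtain ⟨z, hz, h4⟩ := h.left_total a ha
        rw [h.value_zero hx h2, h.value_pair ha hz hb h4 h3] at e
        rw [h.value_pair ha hz hb h4 h3]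
        exact mem_eval_rfind'_zero e
      · have e1 := h.value_succ hm hm' h5
        have e2 : value W q m' ≤ W.card := value_le_card m'
        rw [h.value_right ha hm h4] at hk
        omega
    | succ k ih =>
      intro a b ha hb hab hk
      obtain ⟨x, hx, h1, ⟨h2, h3⟩ |
        ⟨d, hd, z, hz, m, hm, m', hm', p, hp, h2, h3, h4, h5, h6, h7, h8⟩⟩ := hr a ha b hb hab
      · have e := hf hcf ha hx h1
        obtain ⟨z, hz, h4⟩ := h.left_total a ha
        rw [h.value_zero hx h2, h.value_pair ha hz hb h4 h3] at e
        rw [h.value_pair ha hz hb h4 h3]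
        exact mem_eval_rfind'_zero e
      · have e1 := h.value_succ hm hm' h5
        rw [h.value_right ha hm h4] at hk
        have e2 := ih p b hp hb h8 (by rw [h.value_right hp hm' h7]; omega)
        have e3 := hf hcf ha hx h1
        rw [h.value_pair hp hz hm' h6 h7, e1] at e2
        rw [h.value_pair ha hz hm h3 h4, h.value_succ hd hx h2] at e3
        rw [h.value_pair ha hz hm h3 h4]
        exact mem_eval_rfind'_succ e3 e2

end

/-! #### Completeness -/

/-- The intended meaning of the relations, for computations that take at most `k` steps. -/
def Std (k : ℕ) : ℕ → ℕ → ℕ → Prop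
  | 0, a, b => a < b
  | 1, a, b => b = a + 1
  | 2, a, _ => a = 0
  | 3, a, b => b = a.unpair.1
  | 4, a, b => b = a.unpair.2
  | r + 5, a, b => b ∈ Code.evaln k (Denumerable.ofNat Code r) a

theorem Std_graph {k : ℕ} {c : Code} {a b : ℕ} : Std k (graph c) a b ↔ b ∈ c.evaln k a := by
  simp [Std]

/-- With fuel `k` only inputs below `k` converge, so finitely many codes produce finitely many
outputs. -/
theorem exists_output_bound (k M : ℕ) :
    ∃ N, k ≤ N ∧ ∀ c : Code, encode c < M → ∀ a, ∀ b ∈ c.evaln k a, b < N := by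
  -- The default `0` for divergent inputs is harmless, as only an upper bound is wanted.
  let out (p : ℕ × ℕ) : ℕ := ((Denumerable.ofNat Code p.1).evaln k p.2).getD 0
  refine ⟨k + ((Finset.range M ×ˢ Finset.range k).sup out + 1), Nat.le_add_right _ _, ?_⟩
  intro c hc a b hb
  have h := Finset.le_sup (f := out) (b := (encode c, a)) (s := Finset.range M ×ˢ Finset.range k)
    (by simp [hc, Code.evaln_bound hb])
  rw [Option.mem_def] at hb
  have hv : out (encode c, a) = b := by simp [out, hb]
  omega

section

variable {k M N : ℕ} {q : ℕ → ℕ → ℕ → Prop}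

/-- The existence axioms ask only for components and predecessors, which do not exceed the given
number; cutting off at `N` therefore does no damage. -/
theorem isSegment_of_std (hM : 5 ≤ M)
    (hq : ∀ r < M, ∀ a < N, ∀ b < N, (q r a b ↔ Std k r a b)) :
    IsSegment (Set.Iio N) q := by
  have hlt {a b} (ha : a < N) (hb : b < N) : q lt a b ↔ a < b := hq 0 (by omega) a ha b hb
  have hsucc {a b} (ha : a < N) (hb : b < N) : q succ a b ↔ b = a + 1 := hq 1 (by omega) a ha b hb
  have hzero {a} (ha : a < N) : q zero a a ↔ a = 0 := hq 2 (by omega) a ha a ha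
  have hleft {a b} (ha : a < N) (hb : b < N) : q left a b ↔ b = a.unpair.1 :=
    hq 3 (by omega) a ha b hb
  have hright {a b} (ha : a < N) (hb : b < N) : q right a b ↔ b = a.unpair.2 :=
    hq 4 (by omega) a ha b hb
  constructor
  · intro a ha h
    exact lt_irrefl a ((hlt ha ha).1 h)
  · intro a ha b hb c hc h h'
    exact (hlt ha hc).2 (((hlt ha hb).1 h).trans ((hlt hb hc).1 h'))
  · intro a ha b hb
    rw [hlt ha hb, hlt hb ha]
    omega
  · intro a ha b hb h
    rw [hsucc ha hb] at h
    refine ⟨(hlt ha hb).2 (by omega), ?_⟩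
    rintro ⟨c, hc, h1, h2⟩
    rw [hlt ha hc] at h1
    rw [hlt hc hb] at h2
    omega
  · rintro a ha h ⟨b, hb, h'⟩
    rw [hzero ha] at h
    rw [hlt hb ha] at h'
    omega
  · intro n hn
    have := (Nat.unpair_left_le n).trans_lt hn
    exact ⟨_, this, (hleft hn this).2 rfl⟩
  · intro n hn
    have := (Nat.unpair_right_le n).trans_lt hn
    exact ⟨_, this, (hright hn this).2 rfl⟩
  · rintro n hn a ha b hb ⟨h1, h2⟩
    rw [hleft hn ha] at h1
    rw [hright hn hb] at h2
    obtain _ | n := n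
    · left
      rw [Nat.unpair_zero] at h1 h2
      exact ⟨(hzero hn).2 rfl, (hzero ha).2 h1, (hzero hb).2 h2⟩
    · right
      have hn' : n < N := (Nat.lt_succ_self n).trans hn
      have ha' := (Nat.unpair_left_le n).trans_lt hn'
      have hb' := (Nat.unpair_right_le n).trans_lt hn'
      refine ⟨n, hn', _, ha', _, hb', (hsucc hn' hn).2 rfl, (hleft hn' ha').2 rfl,
        (hright hn' hb').2 rfl, ?_⟩
      rw [Next, hsucc ha' ha, hlt ha hb', hsucc ha' hb', hzero hb, hlt hb' ha', hsucc hb' hb,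
        hzero ha, hsucc ha' hb, h1, h2, unpair_succ]
      split_ifs <;> simp <;> omega

/-- One unfolding of `evaln` yields the witnesses. They stay below `N`, being inputs of convergent
evaluations (below `k`), outputs of such evaluations, or components or predecessors of numbers below
`N`. Subcodes have smaller code numbers, so their relations are present. -/
theorem rule_of_std (hM : 5 ≤ M) (hk : k ≤ N)
    (hout : ∀ c : Code, graph c < M → ∀ a, ∀ b ∈ c.evaln k a, b < N)
    (hq : ∀ r < M, ∀ a < N, ∀ b < N, (q r a b ↔ Std k r a b)) (c : Code) (hc : graph c < M)
    {a b : ℕ} (ha : a < N) (hb : b < N) (hab : q (graph c) a b) : Rule (Set.Iio N) q c a b := by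
  have hsucc {a b} (ha : a < N) (hb : b < N) : q succ a b ↔ b = a + 1 := hq 1 (by omega) a ha b hb
  have hzero {a} (ha : a < N) : q zero a a ↔ a = 0 := hq 2 (by omega) a ha a ha
  have hleft {a b} (ha : a < N) (hb : b < N) : q left a b ↔ b = a.unpair.1 :=
    hq 3 (by omega) a ha b hb
  have hright {a b} (ha : a < N) (hb : b < N) : q right a b ↔ b = a.unpair.2 :=
    hq 4 (by omega) a ha b hb
  have hl {a} (ha : a < N) : a.unpair.1 < N := (Nat.unpair_left_le a).trans_lt ha
  have hr {a} (ha : a < N) : a.unpair.2 < N := (Nat.unpair_right_le a).trans_lt ha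
  have hin {c a b} (h : b ∈ Code.evaln k c a) : a < N := (Code.evaln_bound h).trans_le hk
  have hgraph {c a b} (hc : graph c < M) (h : b ∈ Code.evaln k c a) : q (graph c) a b :=
    (hq _ hc _ (hin h) _ (hout c hc a b h)).2 (Std_graph.2 h)
  rw [hq _ hc a ha b hb, Std_graph] at hab
  obtain _ | k := k
  · simp [Code.evaln] at hab
  -- Recursive calls of `prec` and `rfind'` cost one unit of fuel, while all the relations refer to
  -- the same fuel.
  have hmono {c a b} (h : b ∈ Code.evaln k c a) : b ∈ Code.evaln (k + 1) c a :=
    Code.evaln_mono (Nat.le_succ k) h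
  cases c with
  | zero =>
    simp only [Code.evaln, Option.mem_def, Option.bind_eq_bind, Option.bind_eq_some_iff] at hab
    obtain ⟨-, -, hab⟩ := hab
    simp only [Option.pure_def, Option.some.injEq] at hab
    exact (hzero hb).2 hab.symm
  | succ =>
    simp only [Code.evaln, Option.mem_def, Option.bind_eq_bind, Option.bind_eq_some_iff] at hab
    obtain ⟨-, -, hab⟩ := hab
    simp only [Option.pure_def, Option.some.injEq] at hab
    exact (hsucc ha hb).2 hab.symm
  | left =>
    simp only [Code.evaln, Option.mem_def, Option.bind_eq_bind, Option.bind_eq_some_iff] at hab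
    obtain ⟨-, -, hab⟩ := hab
    simp only [Option.pure_def, Option.some.injEq] at hab
    exact (hleft ha hb).2 hab.symm
  | right =>
    simp only [Code.evaln, Option.mem_def, Option.bind_eq_bind, Option.bind_eq_some_iff] at hab
    obtain ⟨-, -, hab⟩ := hab
    simp only [Option.pure_def, Option.some.injEq] at hab
    exact (hright ha hb).2 hab.symm
  | pair f g =>
    have hf : graph f < M := by have := (Code.encode_lt_pair f g).1; simp only [graph] at *; omega
    have hg : graph g < M := by have := (Code.encode_lt_pair f g).2; simp only [graph] at *; omega
    simp [Code.evaln, Option.bind_eq_some_iff, Seq.seq] at hab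
    obtain ⟨-, x, hx, y, hy, rfl⟩ := hab
    have hx' := hout f hf a x hx
    have hy' := hout g hg a y hy
    exact ⟨x, hx', y, hy', hgraph hf hx, hgraph hg hy, (hleft hb hx').2 (by simp),
      (hright hb hy').2 (by simp)⟩
  | comp f g =>
    have hf : graph f < M := by have := (Code.encode_lt_comp f g).1; simp only [graph] at *; omega
    have hg : graph g < M := by have := (Code.encode_lt_comp f g).2; simp only [graph] at *; omega
    simp [Code.evaln, Option.bind_eq_some_iff] at hab
    obtain ⟨-, x, hx, hy⟩ := hab
    exact ⟨x, hout g hg a x hx, hgraph hg hx, hgraph hf hy⟩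
  | prec f g =>
    have hf : graph f < M := by have := (Code.encode_lt_prec f g).1; simp only [graph] at *; omega
    have hg : graph g < M := by have := (Code.encode_lt_prec f g).2; simp only [graph] at *; omega
    simp only [Code.evaln, Option.mem_def, Option.bind_eq_bind, Option.bind_eq_some_iff,
      Nat.unpaired] at hab
    obtain ⟨-, -, hab⟩ := hab
    refine ⟨_, hl ha, _, hr ha, (hleft ha (hl ha)).2 rfl, (hright ha (hr ha)).2 rfl, ?_⟩
    have hy := hr ha
    rcases h : a.unpair.2 with _ | z
    · rw [h] at hab hy
      exact Or.inl ⟨(hzero hy).2 rfl, hgraph hf hab⟩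
    · rw [h] at hab hy
      simp only [Option.bind_eq_some_iff] at hab
      obtain ⟨i, hi, hib⟩ := hab
      replace hi := hmono hi
      have hz : z < N := (Nat.lt_succ_self z).trans hy
      have hp := hin hi
      have hi' := hout _ hc _ _ hi
      -- The nested pair is small because `g` converges on it; its component, the inner pair, is
      -- then small as well.
      have ht := hin hib
      have hr' := hr ht
      rw [Nat.unpair_pair] at hr'
      exact Or.inr ⟨z, hz, _, hp, i, hi', _, hr', _, ht, (hsucc hz hy).2 rfl,
        (hleft hp (hl ha)).2 (by simp), (hright hp hz).2 (by simp), hgraph hc hi,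
        (hleft hr' hz).2 (by simp), (hright hr' hi').2 (by simp), (hleft ht (hl ha)).2 (by simp),
        (hright ht hr').2 (by simp), hgraph hg hib⟩
  | rfind' f =>
    have hf : graph f < M := by have := Code.encode_lt_rfind' f; simp only [graph] at *; omega
    simp only [Code.evaln, Option.mem_def, Option.bind_eq_bind, Option.bind_eq_some_iff,
      Nat.unpaired, Nat.pair_unpair] at hab
    obtain ⟨-, -, x, hx, hab⟩ := hab
    have hx' := hout f hf a x hx
    refine ⟨x, hx', hgraph hf hx, ?_⟩
    split_ifs at hab with h
    · simp only [Option.pure_def, Option.some.injEq] at hab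
      exact Or.inl ⟨(hzero hx').2 h, (hright ha hb).2 hab.symm⟩
    · obtain ⟨d, rfl⟩ := Nat.exists_eq_succ_of_ne_zero h
      have hd : d < N := (Nat.lt_succ_self d).trans hx'
      replace hab := hmono hab
      have hp := hin hab
      -- The incremented counter is in the segment as a component of an input of a convergent
      -- evaluation.
      have hm' := hr hp
      rw [Nat.unpair_pair] at hm'
      exact Or.inr ⟨d, hd, _, hl ha, _, hr ha, _, hm', _, hp, (hsucc hd hx').2 rfl,
        (hleft ha (hl ha)).2 rfl, (hright ha (hr ha)).2 rfl, (hsucc (hr ha) hm').2 rfl,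
        (hleft hp (hl ha)).2 (by simp), (hright hp hm').2 (by simp), hgraph hc hab⟩

theorem rules_of_std (hM : 5 ≤ M) (hk : k ≤ N)
    (hout : ∀ c : Code, graph c < M → ∀ a, ∀ b ∈ c.evaln k a, b < N)
    (hq : ∀ r < M, ∀ a < N, ∀ b < N, (q r a b ↔ Std k r a b)) (c : Code) (hc : graph c < M) :
    Rules (Set.Iio N) q c := by
  have key (c : Code) (hc : graph c < M) (a : ℕ) (ha : a ∈ Set.Iio N) (b : ℕ)
      (hb : b ∈ Set.Iio N) : q (graph c) a b → Rule (Set.Iio N) q c a b :=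
    rule_of_std hM hk hout hq c hc ha hb
  induction c with
  | pair f g hf hg =>
    have := Code.encode_lt_pair f g
    exact ⟨key _ hc, hf (by simp only [graph] at *; omega), hg (by simp only [graph] at *; omega)⟩
  | comp f g hf hg =>
    have := Code.encode_lt_comp f g
    exact ⟨key _ hc, hf (by simp only [graph] at *; omega), hg (by simp only [graph] at *; omega)⟩
  | prec f g hf hg =>
    have := Code.encode_lt_prec f g
    exact ⟨key _ hc, hf (by simp only [graph] at *; omega), hg (by simp only [graph] at *; omega)⟩
  | rfind' f hf =>
    have := Code.encode_lt_rfind' f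
    exact ⟨key _ hc, hf (by simp only [graph] at *; omega)⟩
  | zero => exact ⟨key _ hc, trivial⟩
  | succ => exact ⟨key _ hc, trivial⟩
  | left => exact ⟨key _ hc, trivial⟩
  | right => exact ⟨key _ hc, trivial⟩

end

end Arith

/-! ### First-order formulas as OCL conditions

Class `3` is the universe of the finite structure, association `r` its relation `r`. -/

namespace OCL

def exW (x : ℕ) (φ : Cond) : Cond := .ex (.allInstances 3 false) x φ

def allW (x : ℕ) (φ : Cond) : Cond := .not (exW x (.not φ))

def imp (φ ψ : Cond) : Cond := .not (.and φ (.not ψ))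

def or (φ ψ : Cond) : Cond := .not (.and (.not φ) (.not ψ))

def rel (r x y : ℕ) : Cond := .includesAll (.nav (.var (.it x)) r false false) (.var (.it y))

def same (x y : ℕ) : Cond := .eq (.var (.it x)) (.var (.it y))

/-! ### Truth of the first-order connectives and atoms -/

section Semantics

variable {D : ClassDiagram} {s : Snapshot} {ρ : Env} {φ ψ : Cond} {x y r a b : ℕ}

theorem holds_exW : Cond.Holds D s (exW x φ) ρ ↔
    ∃ o ∈ {o | Fact.inst 3 o ∈ s},
      Cond.Holds D s φ (Function.update ρ (.it x) (some (.obj o))) := by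
  simp only [Cond.Holds, exW, Expr.eval, cond_false, Set.mem_ofPred_eq]
  constructor
  · rintro ⟨_, ⟨o, rfl, h⟩, h'⟩
    exact ⟨o, h, h'⟩
  · rintro ⟨o, h, h'⟩
    exact ⟨_, ⟨o, rfl, h⟩, h'⟩

theorem holds_not : Cond.Holds D s (.not φ) ρ ↔ ¬ Cond.Holds D s φ ρ := Iff.rfl

theorem holds_and : Cond.Holds D s (.and φ ψ) ρ ↔ Cond.Holds D s φ ρ ∧ Cond.Holds D s ψ ρ :=
  Iff.rfl

theorem holds_allW : Cond.Holds D s (allW x φ) ρ ↔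
    ∀ o ∈ {o | Fact.inst 3 o ∈ s},
      Cond.Holds D s φ (Function.update ρ (.it x) (some (.obj o))) := by
  simp [allW, holds_not, holds_exW]

theorem holds_imp : Cond.Holds D s (imp φ ψ) ρ ↔ (Cond.Holds D s φ ρ → Cond.Holds D s ψ ρ) := by
  simp [imp, holds_not, holds_and]

theorem holds_or : Cond.Holds D s (or φ ψ) ρ ↔ Cond.Holds D s φ ρ ∨ Cond.Holds D s ψ ρ := by
  simp only [or, holds_not, holds_and]
  tauto

/-- The object assigned to the iterator variable `x` (`0` if there is none). -/
def look (ρ : Env) (x : ℕ) : ℕ :=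
  match ρ (.it x) with
  | some (.obj o) => o
  | _ => 0

/-- The iterator variable `x` denotes an object. -/
def Bound (ρ : Env) (x : ℕ) : Prop := ρ (.it x) = some (.obj (look ρ x))

theorem look_update : look (Function.update ρ (.it x) (some (.obj a))) y =
    if y = x then a else look ρ y := by
  by_cases h : y = x <;> simp [look, h]

theorem bound_update : Bound (Function.update ρ (.it x) (some (.obj a))) y ↔
    y = x ∨ Bound ρ y := by
  by_cases h : y = x <;> simp [Bound, look, h]

/-- Boundness matters: an undefined `y` denotes the empty collection, and the inclusion would hold
vacuously. -/
theorem holds_rel (hx : Bound ρ x) (hy : Bound ρ y) :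
    Cond.Holds D s (rel r x y) ρ ↔ Fact.link r (look ρ x) (look ρ y) ∈ s := by
  rw [Bound] at hx hy
  simp [Cond.Holds, rel, Expr.eval, hx, hy]

theorem holds_same (hx : Bound ρ x) (hy : Bound ρ y) :
    Cond.Holds D s (same x y) ρ ↔ look ρ x = look ρ y := by
  rw [Bound] at hx hy
  simp [Cond.Holds, same, Expr.eval, hx, hy]

end Semantics

/-! ### Typing of the first-order connectives and atoms -/

section Typing

variable {D : ClassDiagram} {Γ : Var → Option Ty} {φ ψ : Cond} {x y r : ℕ}

/-- `φ` is a well-typed condition without `@pre` and `oclIsNew`. -/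
def Typed (D : ClassDiagram) (φ : Cond) (Γ : Var → Option Ty) : Prop :=
  Expr.HasTy D false φ Γ .bool

/-- Association `r` is a relation on class `3`. -/
def IsRel (D : ClassDiagram) (r : ℕ) : Prop :=
  ∃ d, D.assocs[r]? = some d ∧ d.dom = 3 ∧ d.img = 3

theorem typed_not : Typed D (.not φ) Γ ↔ Typed D φ Γ := by
  simp [Typed, Expr.HasTy]

theorem typed_and : Typed D (.and φ ψ) Γ ↔ Typed D φ Γ ∧ Typed D ψ Γ := by
  simp [Typed, Expr.HasTy]

theorem typed_imp : Typed D (imp φ ψ) Γ ↔ Typed D φ Γ ∧ Typed D ψ Γ := by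
  simp [imp, typed_not, typed_and]

theorem typed_or : Typed D (or φ ψ) Γ ↔ Typed D φ Γ ∧ Typed D ψ Γ := by
  simp [or, typed_not, typed_and]

theorem typed_exW (hD : 3 < D.numClasses)
    (h : Typed D φ (Function.update Γ (.it x) (some (.cls 3)))) : Typed D (exW x φ) Γ :=
  ⟨rfl, .cls 3, ⟨by simp, hD, .refl⟩, h⟩

theorem typed_allW (hD : 3 < D.numClasses)
    (h : Typed D φ (Function.update Γ (.it x) (some (.cls 3)))) : Typed D (allW x φ) Γ :=
  typed_not.2 (typed_exW hD (typed_not.2 h))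

theorem typed_rel (hr : IsRel D r) (hx : Γ (.it x) = some (.cls 3))
    (hy : Γ (.it y) = some (.cls 3)) : Typed D (rel r x y) Γ := by
  obtain ⟨d, hd, h1, h2⟩ := hr
  refine ⟨rfl, .cls 3, ⟨by simp, d, hd, ⟨_, hx, ?_⟩, ?_⟩, ⟨_, hy, .refl⟩⟩
  · rw [cond_false, h1]
    exact .refl
  · rw [cond_false, h2]
    exact .refl

theorem typed_same (hx : Γ (.it x) = some (.cls 3)) (hy : Γ (.it y) = some (.cls 3)) :
    Typed D (same x y) Γ :=
  ⟨rfl, .cls 3, ⟨_, hx, .refl⟩, ⟨_, hy, .refl⟩⟩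

end Typing

/-! #### The theory of a finite segment of arithmetic -/

open Arith

def segmentOrder : Cond :=
  .and (allW 0 (.not (rel lt 0 0))) <|
  .and (allW 0 (allW 1 (allW 2 (imp (rel lt 0 1) (imp (rel lt 1 2) (rel lt 0 2)))))) <|
  .and (allW 0 (allW 1 (or (same 0 1) (or (rel lt 0 1) (rel lt 1 0))))) <|
  .and (allW 0 (allW 1 (imp (rel succ 0 1)
    (.and (rel lt 0 1) (.not (exW 2 (.and (rel lt 0 2) (rel lt 2 1)))))))) <|
  allW 0 (imp (rel zero 0 0) (.not (exW 1 (rel lt 1 0))))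

/-- Variables `1, 2` are the components of the element at hand, `4, 5` those of its predecessor. -/
def next : Cond :=
  or (.and (rel succ 4 1) (.and (rel lt 1 5) (same 2 5))) <|
  or (.and (rel succ 4 5) (.and (same 1 5) (rel zero 2 2))) <|
  or (.and (rel lt 5 4) (.and (same 1 4) (rel succ 5 2))) <|
  .and (same 4 5) (.and (rel zero 1 1) (rel succ 4 2))

def segmentPairing : Cond :=
  .and (allW 0 (exW 1 (rel left 0 1))) <|
  .and (allW 0 (exW 1 (rel right 0 1))) <|
  allW 0 (allW 1 (allW 2 (imp (.and (rel left 0 1) (rel right 0 2))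
    (or (.and (rel zero 0 0) (.and (rel zero 1 1) (rel zero 2 2)))
      (exW 3 (exW 4 (exW 5 (.and (rel succ 3 0)
        (.and (rel left 3 4) (.and (rel right 3 5) next))))))))))

/-- The condition that has to hold for a pair (variables `0` and `1`) in the relation `graph c`. -/
def rule : Code → Cond
  | .zero => rel zero 1 1
  | .succ => rel succ 0 1
  | .left => rel left 0 1
  | .right => rel right 0 1
  | .pair f g => exW 2 (exW 3 (.and (rel (graph f) 0 2)
      (.and (rel (graph g) 0 3) (.and (rel left 1 2) (rel right 1 3)))))
  | .comp f g => exW 2 (.and (rel (graph g) 0 2) (rel (graph f) 2 1))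
  | .prec f g => exW 2 (exW 3 (.and (rel left 0 2) (.and (rel right 0 3)
      (or (.and (rel zero 3 3) (rel (graph f) 2 1))
        (exW 4 (exW 5 (exW 6 (exW 7 (exW 8 (.and (rel succ 4 3) <| .and (rel left 5 2) <|
          .and (rel right 5 4) <| .and (rel (graph (.prec f g)) 5 6) <| .and (rel left 7 4) <|
          .and (rel right 7 6) <| .and (rel left 8 2) <| .and (rel right 8 7) <|
          rel (graph g) 8 1))))))))))
  | .rfind' f => exW 2 (.and (rel (graph f) 0 2)
      (or (.and (rel zero 2 2) (rel right 0 1))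
        (exW 3 (exW 4 (exW 5 (exW 6 (exW 7 (.and (rel succ 3 2) <| .and (rel left 0 4) <|
          .and (rel right 0 5) <| .and (rel succ 5 6) <| .and (rel left 7 4) <|
          .and (rel right 7 6) <| rel (graph (.rfind' f)) 7 1))))))))

def ruleFor (c : Code) : Cond := allW 0 (allW 1 (imp (rel (graph c) 0 1) (rule c)))

def rules : Code → Cond
  | .pair f g => .and (ruleFor (.pair f g)) (.and (rules f) (rules g))
  | .comp f g => .and (ruleFor (.comp f g)) (.and (rules f) (rules g))
  | .prec f g => .and (ruleFor (.prec f g)) (.and (rules f) (rules g))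
  | .rfind' f => .and (ruleFor (.rfind' f)) (rules f)
  | c => ruleFor c

/-- The object that stands for the number `n`. -/
def num : ℕ → Expr .coll
  | 0 => .select (.allInstances 3 false) 0 (rel zero 0 0)
  | n + 1 => .nav (num n) succ false false

/-- The value of the function with code `c` at `n` occurs in the structure. -/
def defined (c : Code) (n : ℕ) : Cond := .ex (num n) 0 (exW 1 (rel (graph c) 0 1))

/-- There is a finite segment of arithmetic with a computation of the function with code `c`
at `n`. -/
def halts (c : Code) (n : ℕ) : Cond :=
  .and segmentOrder (.and segmentPairing (.and (rules c) (defined c n)))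

/-! ### The sentence `halts c n` expresses convergence of `c` at `n` -/

section Semantics

variable (D : ClassDiagram) (s : Snapshot) (ρ : Env)

/-- The universe of the structure. -/
abbrev carrier : Set ℕ := {o | Fact.inst 3 o ∈ s}

/-- The relations of the structure. -/
abbrev relation (r a b : ℕ) : Prop := Fact.link r a b ∈ s

theorem holds_segment : Cond.Holds D s segmentOrder ρ ∧ Cond.Holds D s segmentPairing ρ ↔
    IsSegment (carrier s) (relation s) := by
  simp only [segmentOrder, segmentPairing, next, holds_and, holds_allW, holds_exW, holds_imp,
    holds_or, holds_not, holds_rel, holds_same, look_update, bound_update, if_true, if_false,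
    true_or, or_true, Nat.reduceEqDiff, zero_ne_one, one_ne_zero,
    OfNat.zero_ne_ofNat, OfNat.one_ne_ofNat, OfNat.ofNat_ne_zero, OfNat.ofNat_ne_one]
  exact ⟨fun ⟨⟨h1, h2, h3, h4, h5⟩, h6, h7, h8⟩ => ⟨h1, h2, h3, h4, h5, h6, h7, h8⟩,
    fun h => ⟨⟨h.irrefl, h.trans, h.total, h.succ_spec, h.zero_spec⟩, h.left_total, h.right_total,
      h.unpair⟩⟩

theorem holds_rule (c : Code) {a b : ℕ} (h0 : Bound ρ 0) (h1 : Bound ρ 1) (ha : look ρ 0 = a)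
    (hb : look ρ 1 = b) :
    Cond.Holds D s (rule c) ρ ↔ Rule (carrier s) (relation s) c a b := by
  cases c <;>
  simp only [rule, holds_and, holds_exW,
    holds_or, holds_rel, look_update, bound_update, if_true, if_false, h0, h1, ha, hb,
    true_or, or_true, Nat.reduceEqDiff, OfNat.zero_ne_ofNat,
    OfNat.one_ne_ofNat] <;>
  exact Iff.rfl

theorem holds_ruleFor (c : Code) : Cond.Holds D s (ruleFor c) ρ ↔
    ∀ a ∈ carrier s, ∀ b ∈ carrier s, relation s (graph c) a b →
      Rule (carrier s) (relation s) c a b := by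
  simp only [ruleFor, holds_allW, holds_imp]
  refine forall₂_congr fun a _ => forall₂_congr fun b _ => ?_
  rw [holds_rel (by simp [bound_update]) (by simp [bound_update]),
    holds_rule D s _ c (a := a) (b := b) (by simp [bound_update]) (by simp [bound_update])
      (by simp [look_update]) (by simp [look_update])]
  simp [look_update]

theorem holds_rules (c : Code) :
    Cond.Holds D s (rules c) ρ ↔ Rules (carrier s) (relation s) c := by
  induction c <;> simp_all only [rules, Rules, holds_and, holds_ruleFor, and_true]

variable {D s ρ}

theorem mem_num_zero {v : Val} : v ∈ (Expr.eval D s s (num 0) ρ : Set Val) ↔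
    ∃ o ∈ carrier s, v = .obj o ∧ relation s zero o o := by
  have h (o : ℕ) : Cond.Holds D s (rel zero 0 0) (Function.update ρ (.it 0) (some (.obj o))) ↔
      relation s zero o o := by
    rw [holds_rel (by simp [bound_update]) (by simp [bound_update])]
    simp [look_update]
  constructor
  · rintro ⟨⟨o, rfl, ho⟩, hz⟩
    exact ⟨o, ho, rfl, (h o).1 hz⟩
  · rintro ⟨o, ho, rfl, hz⟩
    exact ⟨⟨o, rfl, ho⟩, (h o).2 hz⟩

theorem mem_num_succ {n : ℕ} {v : Val} : v ∈ (Expr.eval D s s (num (n + 1)) ρ : Set Val) ↔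
    ∃ o o', v = .obj o' ∧ .obj o ∈ (Expr.eval D s s (num n) ρ : Set Val) ∧
      relation s succ o o' := Iff.rfl

theorem holds_defined_obj {c : Code} {o : ℕ} :
    Cond.Holds D s (exW 1 (rel (graph c) 0 1)) (Function.update ρ (.it 0) (some (.obj o))) ↔
      ∃ b ∈ carrier s, relation s (graph c) o b := by
  rw [holds_exW]
  refine exists_congr fun b => and_congr_right fun _ => ?_
  rw [holds_rel (by simp [bound_update]) (by simp [bound_update])]
  simp [look_update]

/-- If the condition `halts c n` holds in some information base, the function with code `c` is
defined at `n`. -/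
theorem dom_of_holds (hlink : ∀ r o o', relation s r o o' → o ∈ carrier s ∧ o' ∈ carrier s)
    {c : Code} {n : ℕ} (h : Cond.Holds D s (halts c n) ρ) : (c.eval n).Dom := by
  obtain ⟨h1, h2, h3, v, hv, h4⟩ := h
  -- Finiteness of information bases is essential here: values are numbers of predecessors.
  have hfin : (carrier s).Finite :=
    (s.finite_toSet.preimage (f := Fact.inst 3) fun _ _ _ _ e => (Fact.inst.inj e).2)
  obtain ⟨W, hW⟩ : ∃ W : Finset ℕ, (W : Set ℕ) = carrier s := ⟨hfin.toFinset, by simp⟩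
  have hseg := (holds_segment D s ρ).1 ⟨h1, h2⟩
  have hrules := (holds_rules D s ρ c).1 h3
  rw [← hW] at hseg hrules
  have hmem {a} : a ∈ carrier s ↔ a ∈ W := by rw [← hW, Finset.mem_coe]
  -- `num n` denotes a collection; it suffices that all its elements have value `n`, and uniqueness
  -- is not needed.
  have hnum : ∀ n v, v ∈ (Expr.eval D s s (num n) ρ : Set Val) →
      ∃ o ∈ W, v = .obj o ∧ value W (relation s) o = n := by
    intro n
    induction n with
    | zero =>
      intro v hv
      obtain ⟨o, ho, rfl, hz⟩ := mem_num_zero.1 hv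
      exact ⟨o, hmem.1 ho, rfl, hseg.value_zero (hmem.1 ho) hz⟩
    | succ n ih =>
      intro v hv
      obtain ⟨o, o', rfl, ho, hs⟩ := mem_num_succ.1 hv
      obtain ⟨_, hoW, e, hval⟩ := ih _ ho
      cases e
      have ho' := hmem.1 (hlink _ _ _ hs).2
      exact ⟨o', ho', rfl, by rw [hseg.value_succ hoW ho' hs, hval]⟩
  obtain ⟨o, ho, rfl, rfl⟩ := hnum n v hv
  obtain ⟨b, hb, hob⟩ := holds_defined_obj.1 h4
  exact Part.dom_iff_mem.2 ⟨_, hseg.mem_eval_of_graph c hrules ho (hmem.1 hb) hob⟩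

/-- An information base with the intended relations on a segment that is large enough satisfies
`halts c n`. -/
theorem holds_of_std {k M N n b : ℕ} {c : Code} (hc : graph c < M) (hk : k ≤ N)
    (hout : ∀ c : Code, graph c < M → ∀ a, ∀ b ∈ c.evaln k a, b < N) (hb : b ∈ c.evaln k n)
    (hW : carrier s = Set.Iio N)
    (hq : ∀ r < M, ∀ a < N, ∀ b < N, (relation s r a b ↔ Std k r a b)) :
    Cond.Holds D s (halts c n) ρ := by
  have hM : 5 ≤ M := by simp only [graph] at hc; omega
  have hseg := isSegment_of_std hM hq
  have hrules := rules_of_std hM hk hout hq c hc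
  rw [← hW] at hseg hrules
  obtain ⟨h1, h2⟩ := (holds_segment D s ρ).2 hseg
  refine ⟨h1, h2, (holds_rules D s ρ c).2 hrules, ?_⟩
  have hnN : n < N := (Code.evaln_bound hb).trans_le hk
  have hbN := hout c hc n b hb
  -- In the standard structure each number is its own name.
  have hnum : ∀ m < N, Val.obj m ∈ (Expr.eval D s s (num m) ρ : Set Val) := by
    intro m
    induction m with
    | zero => exact fun h => mem_num_zero.2 ⟨0, by rw [hW]; exact h, rfl,
        (hq 2 (by omega) 0 h 0 h).2 rfl⟩
    | succ m ih => exact fun h => mem_num_succ.2 ⟨m, m + 1, rfl, ih (by omega),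
        (hq 1 (by omega) m (by omega) (m + 1) h).2 rfl⟩
  refine ⟨.obj n, hnum n hnN, holds_defined_obj.2 ⟨b, by rw [hW]; exact hbN, ?_⟩⟩
  exact (hq _ hc n hnN b hbN).2 (Std_graph.2 hb)

end Semantics

/-! ### Well-typedness of `halts c n` -/

section Typing

variable {D : ClassDiagram}

theorem typed_segment {Γ : Var → Option Ty} (hD : 3 < D.numClasses) (hr : ∀ r < 5, IsRel D r) :
    Typed D segmentOrder Γ ∧ Typed D segmentPairing Γ := by
  unfold segmentOrder segmentPairing next
  constructor
  all_goals repeat' first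
    | refine typed_exW hD ?_ | refine typed_allW hD ?_ | refine typed_and.2 ⟨?_, ?_⟩
    | refine typed_or.2 ⟨?_, ?_⟩ | refine typed_imp.2 ⟨?_, ?_⟩
    | refine typed_rel ?_ ?_ ?_ | refine typed_same ?_ ?_ | refine typed_not.2 ?_
  all_goals first | exact hr _ (by decide) | simp

/-- Relations up to `graph c` suffice because the encodings of subcodes are smaller. -/
theorem typed_rule {Γ : Var → Option Ty} (hD : 3 < D.numClasses) (c : Code)
    (hr : ∀ r ≤ graph c, IsRel D r)
    (h0 : Γ (.it 0) = some (.cls 3)) (h1 : Γ (.it 1) = some (.cls 3)) :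
    Typed D (rule c) Γ := by
  have hr' : ∀ r < 5, IsRel D r := fun r h => hr r (by simp only [graph]; omega)
  have hsub {f : Code} (h : encode f ≤ encode c) : IsRel D (graph f) := hr _ (by simpa using h)
  have hself := hsub le_rfl
  have hrel : IsRel D succ ∧ IsRel D zero ∧ IsRel D left ∧ IsRel D right :=
    ⟨hr' _ (by decide), hr' _ (by decide), hr' _ (by decide), hr' _ (by decide)⟩
  have hsub' : match (generalizing := false) c with
      | .pair f g | .comp f g | .prec f g => IsRel D (graph f) ∧ IsRel D (graph g)
      | .rfind' f => IsRel D (graph f)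
      | .zero | .succ | .left | .right => True := by
    cases c with
    | pair f g => exact ⟨hsub (Code.encode_lt_pair f g).1.le, hsub (Code.encode_lt_pair f g).2.le⟩
    | comp f g => exact ⟨hsub (Code.encode_lt_comp f g).1.le, hsub (Code.encode_lt_comp f g).2.le⟩
    | prec f g => exact ⟨hsub (Code.encode_lt_prec f g).1.le, hsub (Code.encode_lt_prec f g).2.le⟩
    | rfind' f => exact hsub (Code.encode_lt_rfind' f).le
    | _ => trivial
  clear hsub hr hr'
  cases c
  all_goals unfold rule
  all_goals repeat' first
    | refine typed_exW hD ?_ | refine typed_and.2 ⟨?_, ?_⟩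
    | refine typed_or.2 ⟨?_, ?_⟩ | refine typed_rel ?_ ?_ ?_
  all_goals first
    | with_reducible exact hself | with_reducible exact hsub' | with_reducible exact hsub'.1
    | with_reducible exact hsub'.2 | with_reducible exact hrel.1 | with_reducible exact hrel.2.1
    | with_reducible exact hrel.2.2.1 | with_reducible exact hrel.2.2.2
    | (simp; done) | simpa using h0 | simpa using h1

theorem typed_ruleFor {Γ : Var → Option Ty} (hD : 3 < D.numClasses) (c : Code)
    (hr : ∀ r ≤ graph c, IsRel D r) : Typed D (ruleFor c) Γ := by
  refine typed_allW hD (typed_allW hD (typed_imp.2 ⟨?_, ?_⟩))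
  · exact typed_rel (hr _ le_rfl) (by simp) (by simp)
  · exact typed_rule hD c hr (by simp) (by simp)

theorem typed_rules {Γ : Var → Option Ty} (hD : 3 < D.numClasses) (c : Code)
    (hr : ∀ r ≤ graph c, IsRel D r) : Typed D (rules c) Γ := by
  have hsub {f : Code} (h : encode f < encode c) : ∀ r ≤ graph f, IsRel D r :=
    fun r hrf => hr r (by simp only [graph] at *; omega)
  induction c with
  | pair f g hf hg =>
    have := Code.encode_lt_pair f g
    exact typed_and.2 ⟨typed_ruleFor hD _ hr, typed_and.2
      ⟨hf (hsub this.1) fun h => hsub (h.trans this.1),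
        hg (hsub this.2) fun h => hsub (h.trans this.2)⟩⟩
  | comp f g hf hg =>
    have := Code.encode_lt_comp f g
    exact typed_and.2 ⟨typed_ruleFor hD _ hr, typed_and.2
      ⟨hf (hsub this.1) fun h => hsub (h.trans this.1),
        hg (hsub this.2) fun h => hsub (h.trans this.2)⟩⟩
  | prec f g hf hg =>
    have := Code.encode_lt_prec f g
    exact typed_and.2 ⟨typed_ruleFor hD _ hr, typed_and.2
      ⟨hf (hsub this.1) fun h => hsub (h.trans this.1),
        hg (hsub this.2) fun h => hsub (h.trans this.2)⟩⟩
  | rfind' f hf =>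
    have := Code.encode_lt_rfind' f
    exact typed_and.2 ⟨typed_ruleFor hD _ hr, hf (hsub this) fun h => hsub (h.trans this)⟩
  | _ => exact typed_ruleFor hD _ hr

theorem num_hasTy {Γ : Var → Option Ty} (hD : 3 < D.numClasses) (hr : ∀ r < 5, IsRel D r)
    (n : ℕ) : Expr.HasTy D false (num n) Γ (.cls 3) := by
  induction n with
  | zero =>
    refine ⟨⟨by simp, hD, .refl⟩, .cls 3, ⟨by simp, hD, .refl⟩, ?_⟩
    exact typed_rel (hr _ (by decide)) (by simp) (by simp)
  | succ n ih =>
    obtain ⟨d, hd, h1, h2⟩ := hr succ (by decide)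
    refine ⟨by simp, d, hd, ?_, ?_⟩
    · rw [cond_false, h1]
      exact ih
    · rw [cond_false, h2]
      exact .refl

theorem typed_halts {Γ : Var → Option Ty} (hD : 3 < D.numClasses) (c : Code)
    (hr : ∀ r ≤ graph c, IsRel D r) (n : ℕ) : Typed D (halts c n) Γ := by
  have hr' : ∀ r < 5, IsRel D r := fun r h => hr r (by simp only [graph]; omega)
  obtain ⟨h1, h2⟩ := typed_segment (Γ := Γ) hD hr'
  refine typed_and.2 ⟨h1, typed_and.2 ⟨h2, typed_and.2 ⟨typed_rules hD c hr, ?_⟩⟩⟩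
  exact ⟨rfl, .cls 3, num_hasTy hD hr' n,
    typed_exW hD (typed_rel (hr _ le_rfl) (by simp) (by simp))⟩

end Typing

end OCL

/-! ### Artifact termination in terms of reachable states -/

section Termination

variable {B : Model} {fr : FrameRule}

theorem mem_reachesTerm_of_term {A T x : ℕ} {c : Config} (h : Fact.inst T x ∈ c.snap) :
    c ∈ reachesTerm B fr A T x := by
  rw [reachesTerm, ← OrderHom.map_lfp]
  exact Or.inl h

theorem mem_reachesTerm_of_step {A T x : ℕ} {c c' : Config} (h : Fact.inst A x ∈ c.snap)
    (hc : Step B fr c c') (hc' : c' ∈ reachesTerm B fr A T x) : c ∈ reachesTerm B fr A T x := by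
  rw [reachesTerm, ← OrderHom.map_lfp]
  exact Or.inr ⟨h, c', hc, hc'⟩

/-- The states from which `T` is reachable form a pre-fixed point of the operator; the persistence
of `x` is discarded. -/
theorem exists_reachable_of_mem_reachesTerm {A T x : ℕ} {c : Config}
    (h : c ∈ reachesTerm B fr A T x) :
    ∃ c', Relation.ReflTransGen (Step B fr) c c' ∧ Fact.inst T x ∈ c'.snap := by
  refine OrderHom.lfp_le _ (a := {c | ∃ c', Relation.ReflTransGen (Step B fr) c c' ∧
    Fact.inst T x ∈ c'.snap}) ?_ h
  rintro c (h | ⟨-, c', hc, c'', hc', h⟩)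
  · exact ⟨c, .refl, h⟩
  · exact ⟨c'', .head hc hc', h⟩

theorem mem_terminationProperty_of_step {c c' : Config} (hc : c ∈ terminationProperty B fr)
    (h : Step B fr c c') : c' ∈ terminationProperty B fr := by
  rw [terminationProperty, ← OrderHom.map_gfp] at hc
  exact hc.2 c' h

theorem mem_reachesTerm_of_mem_terminationProperty {c : Config}
    (hc : c ∈ terminationProperty B fr) {S : Chart} (hS : S ∈ B.charts) {x : ℕ}
    (hx : Fact.inst S.artifact x ∈ c.snap) : c ∈ reachesTerm B fr S.artifact S.term x := by
  rw [terminationProperty, ← OrderHom.map_gfp] at hc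
  exact hc.1 S hS x hx

/-- The set of all configurations is a post-fixed point, so no invariant of the reachable ones is
needed. -/
theorem terminates_of_forall_mem_reachesTerm (h : ∀ c : Config, ∀ S ∈ B.charts, ∀ x,
    Fact.inst S.artifact x ∈ c.snap → c ∈ reachesTerm B fr S.artifact S.term x) :
    B.Terminates fr :=
  OrderHom.le_gfp _ (a := Set.univ) (fun c _ => ⟨h c, fun _ _ => trivial⟩) trivial

/-- Under both readings of postconditions, a task can be executed if its postcondition can be
satisfied. -/
theorem Contract.exists_effect {A : ℕ} {K : Contract} {self result : Option ℕ} {args : List Val}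
    {s s₀ : Snapshot} (h : K.Post B A self result args s s₀) :
    ∃ s', K.Effect B fr A self result args s s' := by
  -- Sets of changed facts are finite, so inclusion among them is well-founded.
  obtain ⟨s', hs', hmin⟩ := exists_minimalFor_of_wellFoundedLT
    (fun s' => K.Post B A self result args s s') (fun s' => symmDiff s s') ⟨s₀, h⟩
  refine ⟨s', hs', fun _ s'' hs'' hle => ?_⟩
  exact symmDiff_right_injective s (le_antisymm hle (hmin hs'' hle))

end Termination

/-! ### The model of a computation -/

namespace Reduction

open OCL Arith

/-- Class `0` is the artifact, with initial state `1` and termination state `2`; class `3` is the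
universe of a finite structure with `M` binary relations. -/
def diagram (M : ℕ) : ClassDiagram where
  numClasses := 4
  isa := [(1, 0), (2, 0)]
  attrs := []
  assocs := List.replicate M ⟨3, 3, ⟨0, none⟩, ⟨0, none⟩⟩

/-- There is no artifact instance in the termination state, unless the information base contains a
computation of the function with code `c` at `n`. -/
def haltingConstraint (c : Code) (n : ℕ) : Cond :=
  or (.isEmpty (.allInstances 2 false)) (halts c n)

/-- An artifact instance is created in its initial state; the other instances persist. -/
def createTask : Contract where
  params := []
  creates := true
  pre := .tt
  post := .and (.isTypeOf (.var .result) 1)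
    (.includesAll (.allInstances 0 false) (.allInstances 0 true))

/-- All artifact instances pass to the termination state. -/
def closeTask : Contract where
  params := []
  creates := false
  pre := .tt
  post := .includesAll (.allInstances 2 false) (.allInstances 0 true)

/-- The activity diagram with the single task `K`. -/
def taskActivity (K : Contract) : Activity := [.initial 0, .task 0 1 K, .final 1]

def chart : Chart where
  artifact := 0
  init := 1
  term := 2
  initTrans := [(0, .tt)]
  trans := [(1, 1, .tt, 2)]
  activities := [taskActivity createTask, taskActivity closeTask]

/-- The associations `0, …, graph c` provide for arithmetic and for all subcodes of `c`. Only the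
constraint depends on `n`. -/
def model (c : Code) (n : ℕ) : Model where
  diagram := diagram (graph c + 1)
  constraints := [haltingConstraint c n]
  charts := [chart]

/-! #### Well-formedness -/

theorem isA_iff {M c d : ℕ} : (diagram M).IsA c d ↔ c = d ∨ (d = 0 ∧ (c = 1 ∨ c = 2)) := by
  constructor
  · intro h
    induction h with
    | refl => exact Or.inl rfl
    | tail _ h ih => simp [diagram] at h; omega
  · rintro (rfl | ⟨rfl, rfl | rfl⟩)
    · exact .refl
    · exact .single (by simp [diagram])
    · exact .single (by simp [diagram])

theorem isLeaf_iff {M c : ℕ} : (diagram M).IsLeaf 0 c ↔ c = 1 ∨ c = 2 := by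
  rw [ClassDiagram.IsLeaf, isA_iff]
  constructor
  · rintro ⟨rfl | ⟨-, h⟩, hl⟩
    · exact (hl 1 (by simp [diagram])).elim
    · exact h
  · rintro (rfl | rfl) <;> simp [diagram]

theorem isRel_diagram {M r : ℕ} (h : r < M) : IsRel (diagram M) r :=
  ⟨⟨3, 3, ⟨0, none⟩, ⟨0, none⟩⟩, by simp [diagram, h], rfl, rfl⟩

theorem diagram_wellFormed (M : ℕ) : (diagram M).WellFormed where
  isa_lt := by simp [diagram]
  isa_acyclic := by
    have h : ∀ c d, Relation.TransGen (fun c d => (c, d) ∈ (diagram M).isa) c d → d < c := by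
      intro c d h
      induction h with
      | single h => simp [diagram] at h; omega
      | tail _ h ih => simp [diagram] at h; omega
    exact fun c hc => lt_irrefl c (h c c hc)
  attr_lt := by simp [diagram]
  assoc_lt := by simp [diagram]
  mult_le := by simp [diagram]

theorem taskActivity_wellFormed {D : ClassDiagram} {A : ℕ} {K : Contract}
    (hK : K.WellFormed D A) : Activity.WellFormed D A (taskActivity K) where
  node := by simp [taskActivity, Node.WellFormed, hK]
  initial := by
    refine ⟨0, ⟨0, rfl⟩, ?_⟩
    rintro (_ | _ | _ | i) ⟨o, h⟩ <;> simp [taskActivity] at h ⊢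
  outs_nodup := by simp [taskActivity, Node.outs]
  ins_nodup := by simp [taskActivity, Node.ins]
  connected := by simp [taskActivity, Node.outs, Node.ins]

theorem createTask_wellFormed (M : ℕ) : createTask.WellFormed (diagram M) 0 where
  params_lt := by simp [createTask]
  pre_typed := rfl
  post_typed := by
    refine ⟨rfl, ⟨rfl, by simp [diagram], 0, ⟨.cls 0, rfl, .refl⟩, isA_iff.2 (by simp)⟩,
      rfl, .cls 0, ⟨by simp, by simp [diagram], .refl⟩, ⟨by simp, by simp [diagram], .refl⟩⟩

theorem closeTask_wellFormed (M : ℕ) : closeTask.WellFormed (diagram M) 0 where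
  params_lt := by simp [closeTask]
  pre_typed := rfl
  post_typed := ⟨rfl, .cls 0, ⟨by simp, by simp [diagram], isA_iff.2 (by simp)⟩,
    ⟨by simp, by simp [diagram], .refl⟩⟩

theorem chart_wellFormed (M : ℕ) : chart.WellFormed (diagram M) where
  artifact_lt := by simp [chart, diagram]
  artifact_top := by simp [chart, diagram]
  init_leaf := isLeaf_iff.2 (Or.inl rfl)
  term_leaf := isLeaf_iff.2 (Or.inr rfl)
  initTrans := by
    simp only [chart, List.mem_singleton, forall_eq]
    exact ⟨by simp, rfl⟩
  trans := by
    simp only [chart, List.mem_singleton, forall_eq]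
    exact ⟨isLeaf_iff.2 (Or.inl rfl), by simp, rfl, isLeaf_iff.2 (Or.inr rfl)⟩
  activity := by
    simp only [chart, List.mem_cons, List.not_mem_nil, or_false, forall_eq_or_imp, forall_eq]
    exact ⟨taskActivity_wellFormed (createTask_wellFormed M),
      taskActivity_wellFormed (closeTask_wellFormed M)⟩
  creates := by
    simp only [chart, List.mem_singleton, forall_eq]
    rintro P h i o K hK
    cases h
    simp only [taskActivity, List.mem_cons, reduceCtorEq, Node.task.injEq, List.not_mem_nil,
      or_false, false_or] at hK
    rw [hK.2.2]
    rfl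

theorem model_wellFormed (c : Code) (n : ℕ) : (model c n).WellFormed where
  diagram := diagram_wellFormed _
  constraints := by
    simp only [model, List.mem_singleton, forall_eq]
    refine typed_or.2 ⟨⟨rfl, .cls 2, by simp, by simp [diagram], .refl⟩, ?_⟩
    exact typed_halts (by simp [diagram]) c (fun r hr => isRel_diagram (Nat.lt_succ_of_le hr)) n
  constraints_empty := by
    simp only [model, List.mem_singleton, forall_eq]
    refine holds_or.2 (Or.inl ?_)
    simp [Cond.Holds, Expr.eval]
  charts := by
    simp only [model, List.mem_singleton, forall_eq]
    exact chart_wellFormed _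
  arts_nodup := by simp [Model.arts, model]
  arts_disjoint := by simp [Model.arts, model]

/-! #### Information bases -/

open Classical in
/-- The information base with the artifact instances `X` in the termination state and `Y` in the
initial state, and the relations `q r`, `r < M`, on the universe `0, …, N - 1`. -/
noncomputable def base (X Y : Finset ℕ) (M N : ℕ) (q : ℕ → ℕ → ℕ → Prop) : Snapshot :=
  (X ∪ Y).image (Fact.inst 0) ∪ Y.image (Fact.inst 1) ∪ X.image (Fact.inst 2) ∪
  (Finset.range N).image (Fact.inst 3) ∪
  ((Finset.range M ×ˢ Finset.range N ×ˢ Finset.range N).filter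
    fun p => q p.1 p.2.1 p.2.2).image fun p => Fact.link p.1 p.2.1 p.2.2

/-! ### Membership in and legality of the explicit information bases -/

section Base

variable {X Y : Finset ℕ} {M N : ℕ} {q : ℕ → ℕ → ℕ → Prop}

theorem inst_mem_base {c o : ℕ} : Fact.inst c o ∈ base X Y M N q ↔
    (c = 0 ∧ (o ∈ X ∨ o ∈ Y)) ∨ (c = 1 ∧ o ∈ Y) ∨ (c = 2 ∧ o ∈ X) ∨ (c = 3 ∧ o < N) := by
  simp only [base, Finset.mem_union, Finset.mem_image, Fact.inst.injEq, Finset.mem_range,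
    reduceCtorEq, and_false, exists_false, or_false, or_assoc]
  grind

theorem attr_notMem_base {a o v : ℕ} : Fact.attr a o v ∉ base X Y M N q := by
  simp [base]

theorem link_mem_base {r o o' : ℕ} : Fact.link r o o' ∈ base X Y M N q ↔
    r < M ∧ o < N ∧ o' < N ∧ q r o o' := by
  simp [base, and_assoc]

/-- An artifact instance may also name a number of the universe: legality only asks for a unique
leaf below class `0`, which disjointness gives. -/
theorem base_legal (h : Disjoint X Y) : (base X Y M N q).Legal (diagram M) [0] where
  class_lt := by
    intro c o h
    rw [inst_mem_base] at h
    simp only [diagram]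
    omega
  isa := by
    intro c d o hcd h
    rw [inst_mem_base] at h ⊢
    simp only [diagram, List.mem_cons, Prod.mk.injEq, List.not_mem_nil, or_false] at hcd
    grind
  attr_typed := fun _ _ _ h => (attr_notMem_base h).elim
  attr_value := by simp [diagram]
  link_typed := by
    intro r o o' h
    obtain ⟨h1, h2, h3, -⟩ := link_mem_base.1 h
    exact ⟨⟨3, 3, ⟨0, none⟩, ⟨0, none⟩⟩, by simp [diagram, h1], inst_mem_base.2 (by simp [h2]),
      inst_mem_base.2 (by simp [h3])⟩
  img_mult := by
    intro r d hd o _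
    simp only [diagram, List.getElem?_replicate] at hd
    split_ifs at hd
    cases hd
    simp [Mult.Allows]
  dom_mult := by
    intro r d hd o _
    simp only [diagram, List.getElem?_replicate] at hd
    split_ifs at hd
    cases hd
    simp [Mult.Allows]
  state := by
    simp only [List.mem_singleton, forall_eq]
    intro o ho
    rw [inst_mem_base] at ho
    have ho' : o ∈ X ∨ o ∈ Y := by simpa using ho
    rw [Finset.disjoint_left] at h
    simp only [isLeaf_iff, inst_mem_base]
    rcases ho' with hX | hY
    · exact ⟨2, by simp [hX], by rintro c ⟨rfl | rfl, hc⟩ <;> simp_all⟩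
    · refine ⟨1, by simp [hY], ?_⟩
      rintro c ⟨rfl | rfl, hc⟩
      · rfl
      · exact (h (by simpa using hc) hY).elim

end Base

/-! #### Executions -/

variable {c : Code} {n : ℕ} {fr : FrameRule}

/-- The artifact instances in an information base. -/
theorem exists_artifacts (s : Snapshot) : ∃ X : Finset ℕ, ∀ o, o ∈ X ↔ Fact.inst 0 o ∈ s :=
  have h : Function.Injective (Fact.inst 0) := fun _ _ e => (Fact.inst.inj e).2
  ⟨s.preimage (Fact.inst 0) h.injOn, by simp⟩

theorem holds_haltingConstraint {s : Snapshot} {D : ClassDiagram} {ρ : Env} :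
    Cond.Holds D s (haltingConstraint c n) ρ ↔
      (∀ o, Fact.inst 2 o ∉ s) ∨ Cond.Holds D s (halts c n) ρ := by
  rw [haltingConstraint, holds_or]
  refine or_congr_left ?_
  simp only [Cond.Holds, Expr.eval, cond_false, Set.eq_empty_iff_forall_notMem, Set.mem_ofPred_eq]
  exact ⟨fun h o ho => h _ ⟨o, rfl, ho⟩, fun h _ ⟨o, _, ho⟩ => h o ho⟩

theorem allInstances_subset {D : ClassDiagram} {s s' : Snapshot} {ρ : Env} {d d' : ℕ} :
    (Expr.eval D s s' (.allInstances d true) ρ : Set Val) ⊆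
      (Expr.eval D s s' (.allInstances d' false) ρ : Set Val) ↔
      ∀ o, Fact.inst d o ∈ s → Fact.inst d' o ∈ s' := by
  constructor
  · intro h o ho
    obtain ⟨_, e, ho'⟩ := h ⟨o, rfl, ho⟩
    cases e
    exact ho'
  · rintro h _ ⟨o, rfl, ho⟩
    exact ⟨o, rfl, h o ho⟩

theorem holdsPost_createTask {s s' : Snapshot} {M r : ℕ} :
    Cond.HoldsPost (diagram M) s s' createTask.post (taskEnv none (some r) []) ↔
      Fact.inst 1 r ∈ s' ∧ ∀ o, Fact.inst 0 o ∈ s → Fact.inst 0 o ∈ s' := by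
  have h (d : ℕ) : (d, 1) ∉ (diagram M).isa := by simp [diagram]
  refine and_congr ?_ allInstances_subset
  simp [Expr.eval, taskEnv, h]

theorem holdsPost_closeTask {s s' : Snapshot} {M r : ℕ} :
    Cond.HoldsPost (diagram M) s s' closeTask.post (taskEnv (some r) none []) ↔
      ∀ o, Fact.inst 0 o ∈ s → Fact.inst 2 o ∈ s' :=
  allInstances_subset

/-- In every information base a fresh artifact instance can be created. -/
theorem exec_createTask (s : Snapshot) {r : ℕ} (hr : ¬ s.Live r) :
    ∃ s', createTask.Exec (model c n) fr 0 none (some r) s s' ∧ Fact.inst 0 r ∈ s' ∧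
      Fact.inst 1 r ∈ s' ∧ ∀ o, Fact.inst 0 o ∈ s → Fact.inst 0 o ∈ s' := by
  obtain ⟨X, hX⟩ := exists_artifacts s
  -- The witness returns all instances to the initial state and empties the universe, so the
  -- constraint holds trivially. The actual result may differ from it.
  have hpost : createTask.Post (model c n) 0 none (some r) [] s
      (base ∅ (insert r X) (graph c + 1) 0 fun _ _ _ => False) := by
    refine ⟨base_legal (Finset.disjoint_empty_left _), ?_, ?_, holdsPost_createTask.2 ⟨?_, ?_⟩⟩
    · simp only [model, List.mem_singleton, forall_eq]
      exact holds_haltingConstraint.2 (Or.inl fun o => by simp [inst_mem_base])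
    · simp [inst_mem_base]
    · simp [inst_mem_base]
    · intro o ho
      simp [inst_mem_base, hX, ho]
  obtain ⟨s', h⟩ := Contract.exists_effect (fr := fr) hpost
  obtain ⟨h1, h2⟩ := holdsPost_createTask.1 h.1.2.2.2
  exact ⟨s', ⟨by simp, [], .nil, trivial, Or.inr ⟨rfl, rfl, r, hr, rfl, h⟩⟩,
    h.1.2.2.1 r rfl, h1, h2⟩

/-- If the computation halts, all artifact instances can be closed. -/
theorem exec_closeTask (hdom : (c.eval n).Dom) (s : Snapshot) {r : ℕ} (hr : Fact.inst 0 r ∈ s) :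
    ∃ s', closeTask.Exec (model c n) fr 0 (some r) (some r) s s' ∧
      ∀ o, Fact.inst 0 o ∈ s → Fact.inst 2 o ∈ s' := by
  obtain ⟨X, hX⟩ := exists_artifacts s
  obtain ⟨b, hb⟩ := Part.dom_iff_mem.1 hdom
  obtain ⟨k, hk⟩ := Code.evaln_complete.1 hb
  -- The bound has to cover `c` itself and all codes with smaller numbers.
  obtain ⟨N, hkN, hN⟩ := exists_output_bound k (encode c + 1)
  have hpost : closeTask.Post (model c n) 0 (some r) none [] s
      (base X ∅ (graph c + 1) N (Std k)) := by
    refine ⟨base_legal (Finset.disjoint_empty_right _), ?_, by simp, holdsPost_closeTask.2 ?_⟩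
    · simp only [model, List.mem_singleton, forall_eq]
      refine holds_haltingConstraint.2 (Or.inr (holds_of_std (Nat.lt_succ_self _) hkN ?_ hk ?_ ?_))
      · exact fun c' hc' => hN c' (by simp only [graph] at hc'; omega)
      · ext o
        simp [inst_mem_base]
      · intro r hr a ha b hb
        simp only [relation, link_mem_base]
        exact ⟨fun h => h.2.2.2, fun h => ⟨hr, ha, hb, h⟩⟩
    · intro o ho
      simp [inst_mem_base, hX, ho]
  obtain ⟨s', h⟩ := Contract.exists_effect (fr := fr) hpost
  exact ⟨s', ⟨by simpa using hr, [], .nil, trivial, Or.inl ⟨rfl, rfl, h⟩⟩,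
    holdsPost_closeTask.1 h.1.2.2.2⟩

theorem step_launch (s : Snapshot) (R : Multiset Run) :
    Step (model c n) fr ⟨s, R⟩ ⟨s, ⟨0, taskActivity createTask, 1, none, {0}⟩ ::ₘ R⟩ :=
  Step.launch (S := chart) (ε := 0) (φ := .tt) (by simp [model]) (by simp [chart]) rfl trivial
    (by simp [taskActivity])

theorem step_start {s : Snapshot} {R : Multiset Run} {o : ℕ} (h0 : Fact.inst 0 o ∈ s)
    (h1 : Fact.inst 1 o ∈ s) (hR : ∀ p ∈ R, p.self ≠ some o) :
    Step (model c n) fr ⟨s, R⟩ ⟨s, ⟨0, taskActivity closeTask, 2, some o, {0}⟩ ::ₘ R⟩ :=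
  Step.start (S := chart) (v := 1) (ε := 1) (φ := .tt) (by simp [model]) (by simp [chart]) rfl
    h0 h1 hR trivial (by simp [taskActivity])

theorem step_task {s s' : Snapshot} {R : Multiset Run} {K : Contract} {t : ℕ}
    {self self' : Option ℕ} (h : K.Exec (model c n) fr 0 self self' s s')
    (hR : ∀ r ∈ self', ∀ p ∈ R, p.self ≠ some r) :
    Step (model c n) fr ⟨s, ⟨0, taskActivity K, t, self, {0}⟩ ::ₘ R⟩
      ⟨s', ⟨0, taskActivity K, t, self', {1}⟩ ::ₘ R⟩ :=
  Step.task (i := 0) (o := 1) (m := 0) (by simp [taskActivity]) h hR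

theorem step_finish {s : Snapshot} {R : Multiset Run} {K : Contract} {t o : ℕ}
    (h : Fact.inst t o ∈ s) :
    Step (model c n) fr ⟨s, ⟨0, taskActivity K, t, some o, {1}⟩ ::ₘ R⟩ ⟨s, R⟩ :=
  Step.finish (i := 1) (m := 0) (by simp [taskActivity]) h

/-- In an arbitrary configuration a run may have in scope an object absent from the information
base, so both conditions are imposed. -/
theorem exists_fresh (s : Snapshot) (R : Multiset Run) :
    ∃ r, ¬ s.Live r ∧ ∀ p ∈ R, p.self ≠ some r := by
  classical
  let f : Fact → ℕ := fun | .inst _ o => o | .attr _ o _ => o | .link _ o _ => o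
  obtain ⟨r, hr⟩ := Infinite.exists_notMem_finset
    (s.image f ∪ (R.map fun p => p.self.getD 0).toFinset)
  simp only [Finset.mem_union, not_or] at hr
  refine ⟨r, ?_, ?_⟩
  · rintro ⟨c, hc⟩
    exact hr.1 (Finset.mem_image.2 ⟨_, hc, rfl⟩)
  · intro p hp h
    exact hr.2 (Multiset.mem_toFinset.2 (Multiset.mem_map.2 ⟨p, hp, by simp [h]⟩))

/-- The instance `x` may be tied up in another run or be outside the initial state. A fresh `y` is
neither, and the task that `y` runs closes `x` too; both tasks keep `x` alive. -/
theorem mem_reachesTerm (hdom : (c.eval n).Dom) (C : Config) {x : ℕ}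
    (hx : Fact.inst 0 x ∈ C.snap) : C ∈ reachesTerm (model c n) fr 0 2 x := by
  obtain ⟨s, R⟩ := C
  obtain ⟨y, hy, hyR⟩ := exists_fresh s R
  obtain ⟨s₁, hs₁, h0, h1, hA⟩ := exec_createTask (c := c) (n := n) (fr := fr) s hy
  obtain ⟨s₂, hs₂, hT⟩ := exec_closeTask (fr := fr) hdom s₁ h0
  have hR : ∀ r ∈ some y, ∀ p ∈ R, p.self ≠ some r := by simpa using hyR
  refine mem_reachesTerm_of_step hx (step_launch s R) ?_
  refine mem_reachesTerm_of_step hx (step_task hs₁ hR) ?_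
  -- The creating run has to end first, so that `y` is idle when its closing transition starts.
  refine mem_reachesTerm_of_step (hA x hx) (step_finish h1) ?_
  refine mem_reachesTerm_of_step (hA x hx) (step_start h0 h1 hyR) ?_
  refine mem_reachesTerm_of_step (hA x hx) (step_task hs₂ hR) ?_
  exact mem_reachesTerm_of_term (hT x (hA x hx))

/-- The constraint leaves only its first disjunct. Legality keeps the endpoints of links inside the
universe, as the soundness argument requires. -/
theorem term_notMem_of_post (hdom : ¬ (c.eval n).Dom) {A : ℕ} {K : Contract}
    {self result : Option ℕ} {args : List Val} {s s' : Snapshot}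
    (h : K.Post (model c n) A self result args s s') (o : ℕ) : Fact.inst 2 o ∉ s' := by
  obtain ⟨hlegal, hcon, -⟩ := h
  rcases holds_haltingConstraint.1 (hcon _ (List.mem_singleton.2 rfl)) with h | h
  · exact h o
  · refine (hdom (dom_of_holds ?_ h)).elim
    intro r o o' hl
    obtain ⟨d, hd, h1, h2⟩ := hlegal.link_typed r o o' hl
    simp only [model, diagram, List.getElem?_replicate] at hd
    split_ifs at hd
    cases hd
    exact ⟨h1, h2⟩

/-- Only tasks change the information base. -/
theorem term_notMem_of_step (hdom : ¬ (c.eval n).Dom) {C C' : Config}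
    (h : Step (model c n) fr C C') (hC : ∀ o, Fact.inst 2 o ∉ C.snap) (o : ℕ) :
    Fact.inst 2 o ∉ C'.snap := by
  cases h with
  | task hN hK =>
    obtain ⟨-, args, -, -, ⟨-, -, hK, -⟩ | ⟨-, -, r, -, -, hK, -⟩⟩ := hK
    · exact term_notMem_of_post hdom hK o
    · exact term_notMem_of_post hdom hK o
  | _ => exact hC o

theorem model_terminates_iff : (model c n).Terminates fr ↔ (c.eval n).Dom := by
  constructor
  · intro h
    by_contra hdom
    -- Two steps from the empty base produce the instance `0`, which would have to reach a state
    -- that stays empty.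
    obtain ⟨s, hs, h0, h1, -⟩ := exec_createTask (c := c) (n := n) (fr := fr) ∅ (r := 0)
      (by simp [Snapshot.Live])
    have htask := step_task (c := c) (n := n) (R := 0) (t := 1) hs (by simp)
    have hterm := mem_terminationProperty_of_step
      (mem_terminationProperty_of_step h (step_launch ∅ 0)) htask
    obtain ⟨C, hC, hx⟩ := exists_reachable_of_mem_reachesTerm
      (mem_reachesTerm_of_mem_terminationProperty hterm (S := chart) (by simp [model]) h0)
    have hnone : ∀ o, Fact.inst 2 o ∉ C.snap := by
      clear hx
      induction hC with
      | refl => exact term_notMem_of_step hdom htask (by simp)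
      | tail _ hstep ih => exact term_notMem_of_step hdom hstep ih
    exact hnone 0 hx
  · intro hdom
    refine terminates_of_forall_mem_reachesTerm fun C S hS x hx => ?_
    obtain rfl : S = chart := List.mem_singleton.1 hS
    exact mem_reachesTerm hdom C hx

/-! #### Computability of the reduction -/

theorem primrec_pair_const (k : ℕ) {f : ℕ → ℕ} (hf : Primrec f) :
    Primrec fun n => Nat.pair k (f n) :=
  Primrec₂.natPair.comp (Primrec.const k) hf

theorem primrec_num_code : Primrec fun n => (num n).code := by
  have h : Primrec₂ fun (_ : ℕ) (p : ℕ × ℕ) =>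
      Nat.pair 4 (encode (p.2, Arith.succ, false, false)) :=
    Primrec₂.natPair.comp (Primrec.const 4)
      (Primrec.encode.comp ((Primrec.snd.comp Primrec.snd).pair (Primrec.const _)))
  refine (Primrec.nat_rec' Primrec.id (Primrec.const (num 0).code) h).of_eq fun n => ?_
  induction n with
  | zero => rfl
  | succ n ih => simpa [num, Expr.code] using ih

theorem primrec_and_code (φ : Cond) {f : ℕ → Cond} (hf : Primrec fun n => (f n).code) :
    Primrec fun n => (Expr.and φ (f n)).code :=
  primrec_pair_const _ (Primrec.encode.comp ((Primrec.const φ.code).pair hf))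

/-- For fixed `c` everything except `num n` is constant; computability of the rules in `c` is never
needed. -/
theorem primrec_halts_code (c : Code) : Primrec fun n => (halts c n).code := by
  have hdef : Primrec fun n => (defined c n).code :=
    primrec_pair_const _ (Primrec.encode.comp (primrec_num_code.pair (Primrec.const _)))
  exact primrec_and_code _ (primrec_and_code _ (primrec_and_code _ hdef))

theorem primrec_model_code (c : Code) : Primrec fun n => (model c n).code := by
  have hnot {f : ℕ → Cond} (hf : Primrec fun n => (f n).code) :
      Primrec fun n => (Expr.not (f n)).code := primrec_pair_const _ hf
  have hcon : Primrec fun n => (haltingConstraint c n).code :=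
    hnot (primrec_and_code _ (hnot (primrec_halts_code c)))
  refine (Primrec.encode.comp ((Primrec.const (diagram (graph c + 1)).code).pair
    ((Primrec.list_cons.comp hcon (Primrec.const [])).pair
      (Primrec.const [chart.code])))).of_eq fun n => ?_
  simp only [Model.code, model, List.map_cons, List.map_nil]

/-- There is a partial recursive function whose domain is undecidable. -/
theorem exists_code_dom_undecidable :
    ∃ c : Code, ¬ ComputablePred fun n => (c.eval n).Dom := by
  -- The interpreter, run at input `0`, is partial recursive in the program and so has a single
  -- code; its domain is the halting problem.
  have h : Partrec fun n : ℕ => (Denumerable.ofNat Code n).eval 0 :=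
    Code.eval_part.comp (Computable.ofNat Code) (Computable.const 0)
  obtain ⟨c, hc⟩ := Code.exists_code.1 (Partrec.nat_iff.1 h)
  refine ⟨c, fun hdec => ComputablePred.halting_problem 0 ?_⟩
  obtain ⟨f, hf, hdec⟩ := ComputablePred.computable_iff.1 hdec
  refine ComputablePred.computable_iff.2 ⟨fun d => f (encode d), hf.comp Computable.encode, ?_⟩
  funext d
  have hd : c.eval (encode d) = d.eval 0 := by rw [hc]; simp
  rw [← congrFun hdec (encode d), hd]

end Reduction

end BAUML

theorem mainTheorem3 (fr : BAUML.FrameRule) :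
    ¬ ∃ f : ℕ → Bool, Computable f ∧
      ∀ B : BAUML.Model, B.WellFormed → (f B.code = true ↔ B.Terminates fr) := by
  rintro ⟨f, hf, h⟩
  obtain ⟨c, hc⟩ := BAUML.Reduction.exists_code_dom_undecidable
  refine hc (ComputablePred.computable_iff.2
    ⟨fun n => f (BAUML.Reduction.model c n).code,
      hf.comp (BAUML.Reduction.primrec_model_code c).to_comp, ?_⟩)
  funext n
  rw [h _ (BAUML.Reduction.model_wellFormed c n), BAUML.Reduction.model_terminates_iff]
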